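/- Let $\mathbb V=\mathbb R^3$, let $\mathbb M$ be the space of real $3\times3$ matrices and $\mathbb K\subset\mathbb M$ the skew-symmetric matrices. For $A,B\in\mathbb M$ put $\operatorname{skw}A=\tfrac12(A-A^{\mathsf T})$, $A:B=\sum_{i,j}A_{ij}B_{ij}$ and $\Xi A=A^{\mathsf T}-\operatorname{tr}(A)I$. The operators $\operatorname{div}$ and $\operatorname{curl}$ act on matrix fields row by row, in the weak sense, and $H(\operatorname{div};\cdot)$, $H(\operatorname{curl};\cdot)$ are the spaces of $L^2(\Omega)$ matrix fields whose divergence, respectively curl, is in $L^2(\Omega)$. Let $\mathcal T_h$ be a finite conforming tetrahedral mesh in $\mathbb R^3$, i.e. a finite geometric simplicial complex in which every simplex is a face of a tetrahedron, and let $\Omega$ be the interior of the union of its tetrahedra. Let $r\ge 0$ be an integer. For $k\ge0$ and a linear space $\mathbb X\subseteq\mathbb M$, let $\mathcal P_k(\mathcal T_h;\mathbb X)$ be the space of fields that on each tetrahedron are $\mathbb X$-valued polynomials of degree at most $k$. Put $$\tilde Q_h=\mathcal P_{r+1}(\mathcal T_h;\mathbb K)\cap H(\operatorname{div};\mathbb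 K),\qquad M_h=\mathcal P_{r+2}(\mathcal T_h;\mathbb M)\cap H(\operatorname{curl};\mathbb M),\qquad c(\tau,q)=\int_\Omega \operatorname{skw}\tau:q\,dx .$$ Let $v$ be any vertex of $\mathcal T_h$ (interior or on $\partial\Omega$), let $\mathcal T_h^v$ be the set of tetrahedra having $v$ as a vertex, $\overline{\mathcal T_h^v}$ their union, and $\Gamma_o^v$ the set of triangular facets of these tetrahedra that do not contain $v$. Let $$\mathring M_h^v=\{\mu\in M_h:\ \mu=0 \text{ in } \Omega\setminus\overline{\mathcal T_h^v},\ (\Xi\mu)n=0 \text{ on every } f\in\Gamma_o^v\},$$ where $n$ is normal to $f$ and the value on $f$ is the trace from the tetrahedron of $\mathcal T_h^v$ containing $f$. **Lemma.** If $q_h\in\tilde Q_h$ satisfies $c(\operatorname{curl}\mu_h,q_h)=0$ for all $\mu_h\in\mathring M_h^v$, then $q_h$ is constant on $\mathcal T_h^v$: there is one matrix $C\in\mathbb M$ with $q_h=C$ in every tetrahedron of $\mathcal T_h^v$. -/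

import Mathlib

open MeasureTheory Topology Filter
open scoped Matrix ContDiff

noncomputable section

namespace WeakSym

/-- Euclidean three-space. -/
abbrev E3 := EuclideanSpace ℝ (Fin 3)

/-- The space of real `3 × 3` matrices. -/
abbrev Mat3 := Matrix (Fin 3) (Fin 3) ℝ

/-- The skew-symmetric part of a matrix. -/
def skw (A : Mat3) : Mat3 := (1 / 2 : ℝ) • (A - Aᵀ)

/-- The Frobenius product `A : B`. -/
def frob (A B : Mat3) : ℝ := ∑ i, ∑ j, A i j * B i j

/-- The map `Ξ A = Aᵀ - tr(A) I`. -/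
def Xi (A : Mat3) : Mat3 := Aᵀ - A.trace • (1 : Mat3)

/-! ### Weak derivatives, `H(div)` and `H(curl)` for matrix fields (operators act row by row) -/

/-- The gradient of a scalar function, as a triple of partial derivatives. -/
def pgrad (φ : E3 → ℝ) (x : E3) : Fin 3 → ℝ :=
  fun l => fderiv ℝ φ x (EuclideanSpace.single l 1)

/-- Test functions: smooth real functions with compact support inside `Ω`. -/
def IsTest (Ω : Set E3) (φ : E3 → ℝ) : Prop :=
  ContDiff ℝ ∞ φ ∧ HasCompactSupport φ ∧ tsupport φ ⊆ Ω

/-- Square-integrable matrix fields on `Ω`. -/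
def MatL2 (Ω : Set E3) (τ : E3 → Mat3) : Prop :=
  ∀ i j, MemLp (fun x => τ x i j) 2 (volume.restrict Ω)

/-- `d ∈ L²(Ω; ℝ³)` is the weak row-wise divergence of `τ` on `Ω`, `d i = ∑ j, ∂ⱼ (τ i j)`. -/
def HasWeakDiv (Ω : Set E3) (τ : E3 → Mat3) (d : E3 → Fin 3 → ℝ) : Prop :=
  (∀ i, MemLp (fun x => d x i) 2 (volume.restrict Ω)) ∧
  ∀ φ, IsTest Ω φ → ∀ i,
    ∫ x in Ω, d x i * φ x = - ∫ x in Ω, (τ x i) ⬝ᵥ (pgrad φ x)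

/-- `κ ∈ L²(Ω; 𝕄)` is the weak row-wise curl of `μ` on `Ω`: row `i` of `κ` is `∇ × (row i of μ)`. -/
def HasWeakCurl (Ω : Set E3) (μ κ : E3 → Mat3) : Prop :=
  MatL2 Ω κ ∧
  ∀ φ, IsTest Ω φ → ∀ i j,
    ∫ x in Ω, κ x i j * φ x = - ∫ x in Ω, (pgrad φ x ⨯₃ μ x i) j

/-- `τ ∈ H(div; 𝕄)` on `Ω`. -/
def MemHdiv (Ω : Set E3) (τ : E3 → Mat3) : Prop :=
  MatL2 Ω τ ∧ ∃ d, HasWeakDiv Ω τ d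

/-- `μ ∈ H(curl; 𝕄)` on `Ω`. -/
def MemHcurl (Ω : Set E3) (μ : E3 → Mat3) : Prop :=
  MatL2 Ω μ ∧ ∃ κ, HasWeakCurl Ω μ κ

/-- The bilinear form `c(τ, q) = ∫_Ω skw τ : q`. -/
def cForm (Ω : Set E3) (τ q : E3 → Mat3) : ℝ :=
  ∫ x in Ω, frob (skw (τ x)) (q x)

/-! ### Meshes -/

/-- A (conforming) tetrahedral mesh: a finite geometric simplicial complex in which every simplex
is a face of some tetrahedron. -/
structure IsTetMesh (K : Geometry.SimplicialComplex ℝ E3) : Prop where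
  finite : K.faces.Finite
  pure : ∀ s ∈ K.faces, ∃ T ∈ K.faces, s ⊆ T ∧ T.card = 4

/-- The tetrahedra of the mesh, as vertex sets. -/
def cells (K : Geometry.SimplicialComplex ℝ E3) : Set (Finset E3) :=
  {T | T ∈ K.faces ∧ T.card = 4}

/-- The closed tetrahedron (or triangle) spanned by a vertex set. -/
def hull (T : Finset E3) : Set E3 := convexHull ℝ (T : Set E3)

/-- The meshed open domain: the interior of the union of the simplices of the mesh. -/
def domain (K : Geometry.SimplicialComplex ℝ E3) : Set E3 := interior K.space

/-- The tetrahedra of the vertex patch of `v`. -/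
def patchCells (K : Geometry.SimplicialComplex ℝ E3) (v : E3) : Set (Finset E3) :=
  {T | T ∈ cells K ∧ v ∈ T}

/-- The closed region covered by the vertex patch of `v`. -/
def patchRegion (K : Geometry.SimplicialComplex ℝ E3) (v : E3) : Set E3 :=
  ⋃ T ∈ patchCells K v, hull T

/-- `n` is a normal vector of the triangle with vertex set `f`. -/
def IsNormal (f : Finset E3) (n : Fin 3 → ℝ) : Prop :=
  ∀ a ∈ f, ∀ b ∈ f, n ⬝ᵥ (a - b).ofLp = 0

/-! ### Finite element spaces

Fields are determined up to null sets, so their values on the boundaries of the tetrahedra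
are not prescribed. -/

/-- On every (open) tetrahedron the entries of `μ` are polynomials of degree at most `k`. -/
def PiecewisePoly (K : Geometry.SimplicialComplex ℝ E3) (k : ℕ) (μ : E3 → Mat3) : Prop :=
  ∀ T ∈ cells K, ∀ i j, ∃ p : MvPolynomial (Fin 3) ℝ, p.totalDegree ≤ k ∧
    ∀ x ∈ interior (hull T), μ x i j = MvPolynomial.eval (fun l => x l) p

/-- `Q̃_h`: skew-symmetric `H(div)`-conforming fields, piecewise polynomial of degree `r + 1`. -/
def Qt (K : Geometry.SimplicialComplex ℝ E3) (r : ℕ) : Set (E3 → Mat3) :=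
  {q | PiecewisePoly K (r + 1) q ∧
    (∀ T ∈ cells K, ∀ x ∈ interior (hull T), (q x)ᵀ = - q x) ∧
    MemHdiv (domain K) q}

/-- `M_h`: `H(curl)`-conforming matrix fields, piecewise polynomial of degree `r + 2`. -/
def Mh (K : Geometry.SimplicialComplex ℝ E3) (r : ℕ) : Set (E3 → Mat3) :=
  {μ | PiecewisePoly K (r + 2) μ ∧ MemHcurl (domain K) μ}

/-- The fields of `M_h` that vanish off the patch of `v` and satisfy `(Ξ μ) n = 0` on the outer
facets of the patch, i.e. the facets of its tetrahedra that do not contain `v`. The value on a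
facet is the trace from the patch tetrahedron that it belongs to. -/
def Mring (K : Geometry.SimplicialComplex ℝ E3) (r : ℕ) (v : E3) : Set (E3 → Mat3) :=
  {μ | μ ∈ Mh K r ∧
    (∀ x ∈ domain K \ patchRegion K v, μ x = 0) ∧
    ∀ T ∈ patchCells K v, ∀ f ⊆ T, f.card = 3 → v ∉ f →
      ∀ n, IsNormal f n → ∀ x ∈ hull f,
        Tendsto (fun y => Xi (μ y) *ᵥ n) (𝓝[interior (hull T)] x) (𝓝 0)}

/-- The kernel of `c` on `Q̃_h` against the curls of the fields in the patch space. -/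
def kerC (K : Geometry.SimplicialComplex ℝ E3) (r : ℕ) (v : E3) : Set (E3 → Mat3) :=
  {q | q ∈ Qt K r ∧
    ∀ μ ∈ Mring K r v, ∀ κ, HasWeakCurl (domain K) μ κ → cForm (domain K) κ q = 0}

/-- `q` is constant on the patch of `v`: one matrix is its value in all (open) tetrahedra. -/
def ConstOnPatch (K : Geometry.SimplicialComplex ℝ E3) (v : E3) (q : E3 → Mat3) : Prop :=
  ∃ C : Mat3, ∀ T ∈ patchCells K v, ∀ x ∈ interior (hull T), q x = C

end WeakSym

end

namespace WeakSym

/-! Write `q = axl W` on each tetrahedron, with `W` piecewise polynomial of degree `r + 1`. The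
normal component of the row `eᵢ × W` on a facet involves only the tangential part of `W`, so `q ∈
H(div)` makes `W` tangentially continuous across interior facets (`IsAxial.tangential_eq`).

All test fields are attached to an edge `v a`. They have the form `λ_v λ_a m`, with barycentric
coordinates `λ` and `m` piecewise of degree `r`. The bubble `λ_v λ_a` confines them to the star of
the edge and kills them on every facet missing `v` or `a`. Hence tangential compatibility of `m` on
the facets through the edge already puts the field in the patch space (`edgeField_mem_Mring`).

Constancy on each cell: put `t = a - v`, `g = ∂_t W` and `m = t gᵀ - ½ (g · t) I`, so that `Ξ m = g
tᵀ`. The derivative `g` is again tangentially continuous on facets through the edge, because `t` is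
tangent to them. The skew part of a curl pairs with `axl W` as `div (Ξ μ) · W`. Integration by parts
along `t` meets only the facets opposite `v` and `a`, where the bubble vanishes, and leaves `-∑ ∫
λ_v λ_a |∂_t W|²`. This must be zero. Since the edges at `v` span space, `W` is constant on each
cell (`edgeDeriv_eq_zero`, `exists_const_of_mem_patch`).

Jumps: with `m = c ⊗ ∇λ_b` the pairing becomes a boundary flux that survives only on the facet `v a
b`. It shows that the jump `J` there satisfies `(c × J) · (a - v) = 0` for every `c`, and exchanging
`a` and `b` gives the same for `b - v`; hence `J = 0`. On a facet lying in only one cell the same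
argument makes the value itself zero (`facet_dichotomy`).

Globalization: the patch need not be connected through facets. However, cells carrying a nonzero
value have no unshared facet through `v`, so the infinite cones over the cells with that value can
be followed along a generic segment to any other cell of the patch (`const_of_facet_dichotomy`).
Thus either all values are zero or they all agree. -/

/-! ### Dot and cross products in coordinates. -/

theorem dot3 (a b : Fin 3 → ℝ) : a ⬝ᵥ b = a 0 * b 0 + a 1 * b 1 + a 2 * b 2 :=
  Fin.sum_univ_three _

theorem cross_zero' (a b : Fin 3 → ℝ) : (a ⨯₃ b) 0 = a 1 * b 2 - a 2 * b 1 := by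
  simp [cross_apply]

theorem cross_one' (a b : Fin 3 → ℝ) : (a ⨯₃ b) 1 = a 2 * b 0 - a 0 * b 2 := by
  simp [cross_apply]

theorem cross_two' (a b : Fin 3 → ℝ) : (a ⨯₃ b) 2 = a 0 * b 1 - a 1 * b 0 := by
  simp [cross_apply]

/-! ### Polynomial functions -/

/-- `f` is a polynomial function of degree at most `k`. -/
def IsPoly (k : ℕ) (f : E3 → ℝ) : Prop :=
  ∃ p : MvPolynomial (Fin 3) ℝ, p.totalDegree ≤ k ∧ ∀ x, f x = MvPolynomial.eval (fun l => x l) p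

theorem IsPoly.const (k : ℕ) (c : ℝ) : IsPoly k fun _ => c :=
  ⟨MvPolynomial.C c, by simp, by simp⟩

theorem IsPoly.coord (l : Fin 3) : IsPoly 1 fun x => x l :=
  ⟨MvPolynomial.X l, by simp [MvPolynomial.totalDegree_X], by simp⟩

theorem IsPoly.mono {k m : ℕ} {f : E3 → ℝ} (hf : IsPoly k f) (h : k ≤ m) : IsPoly m f := by
  obtain ⟨p, hp, e⟩ := hf
  exact ⟨p, hp.trans h, e⟩

theorem IsPoly.add {k : ℕ} {f g : E3 → ℝ} (hf : IsPoly k f) (hg : IsPoly k g) :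
    IsPoly k fun x => f x + g x := by
  obtain ⟨p, hp, e⟩ := hf
  obtain ⟨s, hs, e'⟩ := hg
  exact ⟨p + s, (MvPolynomial.totalDegree_add _ _).trans (max_le hp hs), by simp [e, e']⟩

theorem IsPoly.mul {k m : ℕ} {f g : E3 → ℝ} (hf : IsPoly k f) (hg : IsPoly m g) :
    IsPoly (k + m) fun x => f x * g x := by
  obtain ⟨p, hp, e⟩ := hf
  obtain ⟨s, hs, e'⟩ := hg
  exact ⟨p * s, (MvPolynomial.totalDegree_mul _ _).trans (add_le_add hp hs), by simp [e, e']⟩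

theorem IsPoly.const_mul {k : ℕ} {f : E3 → ℝ} (hf : IsPoly k f) (c : ℝ) :
    IsPoly k fun x => c * f x := by
  simpa using (IsPoly.const 0 c).mul hf

theorem IsPoly.neg {k : ℕ} {f : E3 → ℝ} (hf : IsPoly k f) : IsPoly k fun x => - f x := by
  simpa using hf.const_mul (-1)

theorem IsPoly.sub {k : ℕ} {f g : E3 → ℝ} (hf : IsPoly k f) (hg : IsPoly k g) :
    IsPoly k fun x => f x - g x := by
  simpa [sub_eq_add_neg] using hf.add hg.neg

theorem IsPoly.sum {k : ℕ} {ι : Type*} (s : Finset ι) {f : ι → E3 → ℝ}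
    (hf : ∀ i ∈ s, IsPoly k (f i)) : IsPoly k fun x => ∑ i ∈ s, f i x := by
  classical
  induction s using Finset.induction_on with
  | empty => simpa using IsPoly.const k 0
  | insert a s ha ih =>
    simp only [Finset.sum_insert ha]
    exact (hf a (by simp)).add (ih fun i hi => hf i (by simp [hi]))

theorem contDiff_eval (p : MvPolynomial (Fin 3) ℝ) :
    ContDiff ℝ ∞ fun x : E3 => MvPolynomial.eval (fun l => x l) p := by
  induction p using MvPolynomial.induction_on with
  | C a => simpa using contDiff_const
  | add p q hp hq =>
    simp only [map_add]
    exact hp.add hq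
  | mul_X p n hp =>
    simp only [map_mul, MvPolynomial.eval_X]
    exact hp.mul (EuclideanSpace.proj n : E3 →L[ℝ] ℝ).contDiff

theorem IsPoly.contDiff {k : ℕ} {f : E3 → ℝ} (hf : IsPoly k f) : ContDiff ℝ ∞ f := by
  obtain ⟨p, -, e⟩ := hf
  rw [funext e]
  exact contDiff_eval p

theorem totalDegree_pderiv_le (p : MvPolynomial (Fin 3) ℝ) (l : Fin 3) {k : ℕ}
    (hp : p.totalDegree ≤ k + 1) : (MvPolynomial.pderiv l p).totalDegree ≤ k := by
  rw [p.as_sum, map_sum]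
  refine MvPolynomial.totalDegree_finsetSum_le fun s hs => ?_
  rw [MvPolynomial.pderiv_monomial]
  have h1 := (MvPolynomial.le_totalDegree hs).trans hp
  rcases Nat.eq_zero_or_pos (s l) with h0 | h0
  · simp [h0]
  · refine (MvPolynomial.totalDegree_monomial_le _ _).trans ?_
    -- Truncated subtraction is invertible here because `0 < s l`; for `s l = 0` the monomial has
    -- zero derivative.
    have : s = (s - Finsupp.single l 1) + Finsupp.single l 1 := by
      ext j
      by_cases hj : l = j
      · subst hj; simp; omega
      · simp [hj]
    rw [this, Finsupp.sum_add_index' (by simp) (by simp), Finsupp.sum_single_index (by simp)] at h1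
    change (s - Finsupp.single l 1).sum (fun _ e => e) ≤ k
    omega

theorem hasFDerivAt_eval (p : MvPolynomial (Fin 3) ℝ) (x : E3) :
    HasFDerivAt (fun y : E3 => MvPolynomial.eval (fun l => y l) p)
      (∑ l, MvPolynomial.eval (fun l => x l) (MvPolynomial.pderiv l p) •
        (EuclideanSpace.proj l : E3 →L[ℝ] ℝ)) x := by
  induction p using MvPolynomial.induction_on with
  | C a => simpa using hasFDerivAt_const (𝕜 := ℝ) a x
  | add p q hp hq =>
    simp only [map_add]
    refine (hp.fun_add hq).congr_fderiv ?_
    simp [add_smul, Finset.sum_add_distrib]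
  | mul_X p n hp =>
    have := hp.fun_mul ((EuclideanSpace.proj n : E3 →L[ℝ] ℝ).hasFDerivAt (x := x))
    simp only [map_mul, MvPolynomial.eval_X]
    refine this.congr_fderiv ?_
    ext v
    simp only [Derivation.leibniz, MvPolynomial.pderiv_X, map_add, smul_eq_mul, map_mul,
      MvPolynomial.eval_X, FunLike.coe_sum, FunLike.coe_smul, FunLike.coe_add, Finset.sum_apply,
      Pi.add_apply, Pi.smul_apply, add_mul, Finset.sum_add_distrib, Pi.single_apply]
    congr 1
    · fin_cases n <;> simp
    · simp [Finset.mul_sum, mul_assoc]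

theorem IsPoly.fderiv {k : ℕ} {f : E3 → ℝ} (hf : IsPoly (k + 1) f) (t : E3) :
    IsPoly k fun x => fderiv ℝ f x t := by
  obtain ⟨p, hp, e⟩ := hf
  have : f = fun x => MvPolynomial.eval (fun l => x l) p := funext e
  have h2 : (fun x => _root_.fderiv ℝ f x t) = fun x => ∑ l, t l *
      MvPolynomial.eval (fun l => x l) (MvPolynomial.pderiv l p) := by
    funext x
    rw [this, (hasFDerivAt_eval p x).fderiv]
    simp [mul_comm]
  rw [h2]
  exact IsPoly.sum _ fun l _ => IsPoly.const_mul ⟨_, totalDegree_pderiv_le p l hp, fun _ => rfl⟩ _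

theorem IsPoly.affine (f : E3 →ᵃ[ℝ] ℝ) : IsPoly 1 f := by
  have : (f : E3 → ℝ) = fun x => f 0 + ∑ l, f.linear (EuclideanSpace.single l 1) * x l := by
    funext x
    have h1 : f x = f.linear x + f 0 := by
      simpa using f.map_vadd 0 x
    have h2 : x = ∑ l, x l • EuclideanSpace.single l (1 : ℝ) := by
      ext j; simp [Finset.sum_apply, Pi.single_apply]
    rw [h1, add_comm]
    conv_lhs => rw [h2]
    simp [mul_comm]
  rw [this]
  exact (IsPoly.const 1 _).add (IsPoly.sum _ fun l _ => (IsPoly.coord l).const_mul _)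

/-! ### Barycentric coordinates of a tetrahedron -/

/-- `T` is the vertex set of a nondegenerate tetrahedron. -/
structure IsTet (T : Finset E3) : Prop where
  card : T.card = 4
  indep : AffineIndependent ℝ ((↑) : T → E3)

theorem IsTet.span (T : Finset E3) (hT : IsTet T) :
    affineSpan ℝ (Set.range ((↑) : T → E3)) = ⊤ := by
  rw [hT.indep.affineSpan_eq_top_iff_card_eq_finrank_add_one]
  simp [hT.card]

/-- The vertices of a nondegenerate tetrahedron as an affine basis. -/
noncomputable def IsTet.basis {T : Finset E3} (hT : IsTet T) : AffineBasis T ℝ E3 :=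
  ⟨(↑), hT.indep, hT.span⟩

open Classical in
/-- The barycentric coordinate of `T` at the vertex `p`, and zero if `p` is not a vertex of `T`. -/
noncomputable def bary (T : Finset E3) (p : E3) : E3 →ᵃ[ℝ] ℝ :=
  if h : IsTet T ∧ p ∈ T then h.1.basis.coord ⟨p, h.2⟩ else 0

theorem bary_of_notMem {T : Finset E3} {p : E3} (hp : p ∉ T) (x : E3) : bary T p x = 0 := by
  simp [bary, hp]

theorem bary_eq {T : Finset E3} (hT : IsTet T) (p : T) : bary T p = hT.basis.coord p := by
  simp [bary, hT]

theorem bary_self {T : Finset E3} (hT : IsTet T) {p : E3} (hp : p ∈ T) : bary T p p = 1 := by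
  have := hT.basis.coord_apply_eq ⟨p, hp⟩
  rwa [← bary_eq hT ⟨p, hp⟩] at this

/-- `p` need not be a vertex of `T`: the default value zero of `bary` covers that case, so `bary ·
p` is a piecewise linear hat function over all cells. -/
theorem bary_ne {T : Finset E3} (hT : IsTet T) {p a : E3} (ha : a ∈ T) (h : a ≠ p) :
    bary T p a = 0 := by
  by_cases hp : p ∈ T
  · have := hT.basis.coord_apply_ne (i := ⟨p, hp⟩) (j := ⟨a, ha⟩) (by simpa using h.symm)
    rwa [← bary_eq hT ⟨p, hp⟩] at this
  · exact bary_of_notMem hp a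

theorem sum_bary {T : Finset E3} (hT : IsTet T) (x : E3) : ∑ p ∈ T, bary T p x = 1 := by
  rw [← hT.basis.sum_coord_apply_eq_one x, ← Finset.sum_coe_sort]
  exact Finset.sum_congr rfl fun p _ => by rw [bary_eq hT]

theorem sum_bary_smul {T : Finset E3} (hT : IsTet T) (x : E3) : ∑ p ∈ T, bary T p x • p = x := by
  conv_rhs => rw [← hT.basis.linear_combination_coord_eq_self x]
  rw [← Finset.sum_coe_sort]
  exact Finset.sum_congr rfl fun p _ => by rw [bary_eq hT]; rfl

theorem mem_hull_iff {T : Finset E3} (hT : IsTet T) {x : E3} :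
    x ∈ hull T ↔ ∀ p ∈ T, 0 ≤ bary T p x := by
  have h := hT.basis.convexHull_eq_nonneg_coord
  have h2 : Set.range hT.basis = (T : Set E3) := Subtype.range_coe
  rw [h2] at h
  rw [hull, h]
  simp [← bary_eq hT]

theorem mem_interior_hull_iff {T : Finset E3} (hT : IsTet T) {x : E3} :
    x ∈ interior (hull T) ↔ ∀ p ∈ T, 0 < bary T p x := by
  have h := hT.basis.interior_convexHull
  have h2 : Set.range hT.basis = (T : Set E3) := Subtype.range_coe
  rw [h2] at h
  rw [hull, h]
  simp [← bary_eq hT]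

theorem bary_isPoly (T : Finset E3) (p : E3) : IsPoly 1 (bary T p) := IsPoly.affine _

theorem bary_continuous (T : Finset E3) (p : E3) : Continuous (bary T p) :=
  (bary_isPoly T p).contDiff.continuous

theorem bary_add_smul (T : Finset E3) (p x u : E3) (s : ℝ) :
    bary T p (x + s • u) = bary T p x + s * (bary T p).linear u := by
  have := (bary T p).map_vadd x (s • u)
  simp only [vadd_eq_add, map_smul, smul_eq_mul] at this
  rw [add_comm x, this, add_comm]

theorem bary_linear_sub (T : Finset E3) (p x y : E3) :
    (bary T p).linear (x - y) = bary T p x - bary T p y := by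
  simpa using (bary T p).linearMap_vsub x y

/-- The normal `(a - v) × (b - v)` of the triangle `v a b`. -/
def triNormal (v a b : E3) : Fin 3 → ℝ := (a - v).ofLp ⨯₃ (b - v).ofLp

/-- Six times the signed volume of the tetrahedron `v a b d`. -/
def vol6 (v a b d : E3) : ℝ := triNormal v a b ⬝ᵥ (d - v).ofLp

/-- `T` is a nondegenerate tetrahedron with the four vertices `v`, `a`, `b`, `d`. -/
structure Labeled (T : Finset E3) (v a b d : E3) : Prop where
  tet : IsTet T
  mem_iff : ∀ p, p ∈ T ↔ p = v ∨ p = a ∨ p = b ∨ p = d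
  va : v ≠ a
  vb : v ≠ b
  vd : v ≠ d
  ab : a ≠ b
  ad : a ≠ d
  bd : b ≠ d

namespace Labeled

variable {T : Finset E3} {v a b d : E3}

theorem rotate (h : Labeled T v a b d) : Labeled T v b d a :=
  ⟨h.tet, fun p => by rw [h.mem_iff]; tauto, h.vb, h.vd, h.va, h.bd, h.ab.symm, h.ad.symm⟩

theorem swap (h : Labeled T v a b d) : Labeled T v a d b :=
  ⟨h.tet, fun p => by rw [h.mem_iff]; tauto, h.va, h.vd, h.vb, h.ad, h.ab, h.bd.symm⟩

theorem mem_v (h : Labeled T v a b d) : v ∈ T := by simp [h.mem_iff]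
theorem mem_a (h : Labeled T v a b d) : a ∈ T := by simp [h.mem_iff]
theorem mem_b (h : Labeled T v a b d) : b ∈ T := by simp [h.mem_iff]
theorem mem_d (h : Labeled T v a b d) : d ∈ T := by simp [h.mem_iff]

theorem sum_eq (h : Labeled T v a b d) {M : Type*} [AddCommMonoid M] (f : E3 → M) :
    ∑ p ∈ T, f p = f v + (f a + (f b + f d)) := by
  have := h.va; have := h.vb; have := h.vd; have := h.ab; have := h.ad; have := h.bd
  have e : T = {v, a, b, d} := by ext p; simp [h.mem_iff]
  rw [e, Finset.sum_insert (by simp [*]), Finset.sum_insert (by simp [*]),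
    Finset.sum_insert (by simp [*]), Finset.sum_singleton]

theorem forall_iff (h : Labeled T v a b d) {P : E3 → Prop} :
    (∀ p ∈ T, P p) ↔ P v ∧ P a ∧ P b ∧ P d := by
  simp [h.mem_iff]

end Labeled

theorem IsTet.exists_labeled_of_three {T : Finset E3} (hT : IsTet T) {v a b : E3} (hv : v ∈ T)
    (ha : a ∈ T) (hb : b ∈ T) (hva : v ≠ a) (hvb : v ≠ b) (hab : a ≠ b) :
    ∃ d, Labeled T v a b d := by
  have hsub : ({v, a, b} : Finset E3) ⊆ T := by simp [Finset.insert_subset_iff, *]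
  have h3 : ({v, a, b} : Finset E3).card = 3 := Finset.card_eq_three.2 ⟨v, a, b, hva, hvb, hab, rfl⟩
  have h1 : (T \ {v, a, b}).card = 1 := by
    rw [Finset.card_sdiff_of_subset hsub, hT.card, h3]
  obtain ⟨d, hd⟩ := Finset.card_eq_one.1 h1
  have key : ∀ p, (p ∈ T ∧ ¬ (p = v ∨ p = a ∨ p = b)) ↔ p = d := by
    intro p
    simpa using Finset.ext_iff.1 hd p
  have hd' := (key d).2 rfl
  simp only [not_or] at hd'
  refine ⟨d, hT, fun p => ⟨fun hp => ?_, ?_⟩, hva, hvb, Ne.symm hd'.2.1, hab, Ne.symm hd'.2.2.1,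
    Ne.symm hd'.2.2.2⟩
  · have := key p
    tauto
  · rintro (rfl | rfl | rfl | rfl)
    exacts [hv, ha, hb, hd'.1]

theorem IsTet.exists_mem_notMem {T : Finset E3} (hT : IsTet T) (s : Finset E3) (hs : s.card ≤ 3) :
    ∃ p ∈ T, p ∉ s :=
  Finset.exists_mem_notMem_of_card_lt_card (by rw [hT.card]; omega)

theorem IsTet.exists_labeled_of_two {T : Finset E3} (hT : IsTet T) {v a : E3} (hv : v ∈ T)
    (ha : a ∈ T) (hva : v ≠ a) : ∃ b d, Labeled T v a b d := by
  obtain ⟨b, hb, hb'⟩ := hT.exists_mem_notMem {v, a} (Finset.card_le_two.trans (by norm_num))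
  simp only [Finset.mem_insert, Finset.mem_singleton, not_or] at hb'
  exact ⟨b, hT.exists_labeled_of_three hv ha hb hva (Ne.symm hb'.1) (Ne.symm hb'.2)⟩

theorem IsTet.exists_labeled_of_one {T : Finset E3} (hT : IsTet T) {v : E3} (hv : v ∈ T) :
    ∃ a b d, Labeled T v a b d := by
  obtain ⟨a, ha, ha'⟩ := hT.exists_mem_notMem {v} (by simp)
  exact ⟨a, hT.exists_labeled_of_two hv ha (by simpa [eq_comm] using ha')⟩

/-- Cramer's rule: in the expansion of `x - v` along the three edges at `v`, the vector `triNormal v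
a b` kills the first two terms. -/
theorem bary_mul_vol6 {v a b d : E3} {T : Finset E3} (h : Labeled T v a b d) (x : E3) :
    bary T d x * vol6 v a b d = triNormal v a b ⬝ᵥ (x - v).ofLp := by
  have h1 := sum_bary h.tet x
  have h2 := sum_bary_smul h.tet x
  rw [h.sum_eq] at h1 h2
  generalize bary T v x = lv at *
  generalize bary T a x = la at *
  generalize bary T b x = lb at *
  generalize bary T d x = ld at *
  have h3 : lv = 1 - la - lb - ld := by linarith
  subst h3
  rw [← h2]
  simp only [vol6, triNormal, dot3, cross_zero', cross_one', cross_two', smul_eq_mul, WithLp.ofLp_sub, Pi.sub_apply, WithLp.ofLp_add,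
    Pi.add_apply, WithLp.ofLp_smul, Pi.smul_apply]
  ring

/-- A zero volume would force `triNormal v a b = 0` by `bary_mul_vol6`, making `a - v` and `b - v`
parallel, which the barycentric coordinate at `b` detects. -/
theorem vol6_ne_zero {v a b d : E3} {T : Finset E3} (h : Labeled T v a b d) :
    vol6 v a b d ≠ 0 := by
  intro h0
  have key := bary_mul_vol6 h
  simp only [h0, mul_zero] at key
  have hN : triNormal v a b = 0 := by
    funext l
    have := key (v + EuclideanSpace.single l 1)
    simpa using this.symm
  have ha := h.mem_a
  have hv := h.mem_v
  have hb := h.mem_b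
  set u := (a - v).ofLp with hu
  have hb1 : (bary T b).linear (a - v) = 0 := by
    rw [bary_linear_sub, bary_ne h.tet ha h.ab, bary_ne h.tet hv h.vb, sub_zero]
  have hb2 : (bary T b).linear (b - v) = 1 := by
    rw [bary_linear_sub, bary_self h.tet hb, bary_ne h.tet hv h.vb, sub_zero]
  have hune : (a - v).ofLp ⬝ᵥ (a - v).ofLp ≠ 0 := by
    rw [Ne, dotProduct_self_eq_zero]
    intro h'
    apply h.va
    ext l
    have := congrFun h' l
    simp at this
    linarith
  -- Expansion of `u × (u × w) = 0` for `u = a - v`, `w = b - v`.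
  have h4 : ((a - v).ofLp ⬝ᵥ (a - v).ofLp) • (b - v) = ((a - v).ofLp ⬝ᵥ (b - v).ofLp) • (a - v) := by
    ext l
    have e0 := congrFun hN 0
    have e1 := congrFun hN 1
    have e2 := congrFun hN 2
    simp [triNormal, cross_zero', cross_one', cross_two'] at e0 e1 e2
    simp only [dot3, PiLp.smul_apply, smul_eq_mul, PiLp.sub_apply, WithLp.ofLp_sub, Pi.sub_apply]
    fin_cases l
    · simp; linear_combination (-(a 1 - v 1)) * e2 + (a 2 - v 2) * e1
    · simp; linear_combination (a 0 - v 0) * e2 - (a 2 - v 2) * e0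
    · simp; linear_combination (a 1 - v 1) * e0 - (a 0 - v 0) * e1
  have := congrArg (bary T b).linear h4
  simp only [map_smul, hb1, hb2, smul_eq_mul, mul_one, mul_zero] at this
  exact hune this

/-! ### Integration over tetrahedra and triangles -/

/-- The open reference triangle. -/
def refTri : Set (Fin 2 → ℝ) := {s | 0 < s 0 ∧ 0 < s 1 ∧ s 0 + s 1 < 1}

/-- The affine parametrization of the triangle `v a b`. -/
noncomputable def triPt (v a b : E3) (s : Fin 2 → ℝ) : E3 := v + s 0 • (a - v) + s 1 • (b - v)

/-- The normalized integral of `h` over the triangle `v a b`. -/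
noncomputable def triInt (v a b : E3) (h : E3 → ℝ) : ℝ := ∫ s in refTri, h (triPt v a b s)

theorem triPt_continuous (v a b : E3) : Continuous (triPt v a b) := by
  unfold triPt; fun_prop

theorem isOpen_refTri : IsOpen refTri := by
  unfold refTri
  exact (isOpen_lt continuous_const (continuous_apply 0)).inter
    ((isOpen_lt continuous_const (continuous_apply 1)).inter
      (isOpen_lt ((continuous_apply 0).add (continuous_apply 1)) continuous_const))

theorem refTri_subset : refTri ⊆ Set.Icc 0 1 := by
  rintro s ⟨h0, h1, h2⟩
  constructor <;> intro i <;> fin_cases i <;> simp <;> linarith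

theorem integrableOn_refTri {h : (Fin 2 → ℝ) → ℝ} (hh : Continuous h) :
    IntegrableOn h refTri :=
  (hh.continuousOn.integrableOn_compact isCompact_Icc).mono_set refTri_subset

theorem triInt_add (v a b : E3) {h g : E3 → ℝ} (hh : Continuous h) (hg : Continuous g) :
    triInt v a b (fun x => h x + g x) = triInt v a b h + triInt v a b g :=
  integral_add (integrableOn_refTri (hh.comp (triPt_continuous v a b)))
    (integrableOn_refTri (hg.comp (triPt_continuous v a b)))

theorem triInt_const_mul (v a b : E3) (c : ℝ) (h : E3 → ℝ) :
    triInt v a b (fun x => c * h x) = c * triInt v a b h :=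
  integral_const_mul _ _

theorem triInt_congr {v a b : E3} {h g : E3 → ℝ}
    (H : ∀ s ∈ refTri, h (triPt v a b s) = g (triPt v a b s)) : triInt v a b h = triInt v a b g :=
  setIntegral_congr_fun isOpen_refTri.measurableSet H

/-- Affine change of variables with columns `a - v`, `b - v`, `d - v`. The third coordinate is split
off so that Fubini can integrate along `d - v` first. -/
theorem integral_E3_eq (f : E3 → ℝ) (v a b d : E3) (hD : vol6 v a b d ≠ 0) :
    ∫ x, f x = |vol6 v a b d| * ∫ z : ℝ × (Fin 2 → ℝ), f (triPt v a b z.2 + z.1 • (d - v)) := by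
  set M : Matrix (Fin 3) (Fin 3) ℝ :=
    Matrix.of fun i j => (![(a - v).ofLp, (b - v).ofLp, (d - v).ofLp] j) i with hM
  have hdet : M.det = vol6 v a b d := by
    rw [Matrix.det_fin_three]
    simp [hM, vol6, triNormal, dot3, cross_zero', cross_one', cross_two']
    ring
  have h1 : ∫ x, f x = ∫ u : Fin 3 → ℝ, f (v + WithLp.toLp 2 u) := by
    rw [← integral_add_left_eq_self f v]
    exact ((EuclideanSpace.volume_preserving_symm_measurableEquiv_toLp (Fin 3)).symm.integral_comp'
      (fun x => f (v + x))).symm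
  have h2 : ∫ s : Fin 3 → ℝ, f (v + WithLp.toLp 2 (Matrix.toLin' M s)) =
      |M.det|⁻¹ * ∫ u : Fin 3 → ℝ, f (v + WithLp.toLp 2 u) := by
    have hM0 : M.det ≠ 0 := by rwa [hdet]
    have hinj : Function.Injective (Matrix.toLin' M) := by
      rw [Matrix.toLin'_apply']
      exact Matrix.mulVec_injective_iff_isUnit.2 ((Matrix.isUnit_iff_isUnit_det M).2 hM0.isUnit)
    have hemb : MeasurableEmbedding (Matrix.toLin' M) :=
      (LinearMap.continuous_of_finiteDimensional _).measurableEmbedding hinj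
    rw [← hemb.integral_map fun u => f (v + WithLp.toLp 2 u),
      Real.map_matrix_volume_pi_eq_smul_volume_pi hM0, integral_smul_measure,
      ENNReal.toReal_ofReal (abs_nonneg _), abs_inv, smul_eq_mul]
  have h3 : ∫ z : ℝ × (Fin 2 → ℝ), f (triPt v a b z.2 + z.1 • (d - v)) =
      ∫ s : Fin 3 → ℝ, f (v + WithLp.toLp 2 (Matrix.toLin' M s)) := by
    rw [← (volume_preserving_piFinSuccAbove (fun _ : Fin 3 => ℝ) 2).integral_comp'
      (fun z : ℝ × (Fin 2 → ℝ) => f (triPt v a b z.2 + z.1 • (d - v)))]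
    refine integral_congr_ae (Eventually.of_forall fun s => ?_)
    have e1 : ((2 : Fin 3).succAbove 0) = 0 := rfl
    have e2 : ((2 : Fin 3).succAbove 1) = 1 := rfl
    simp only [triPt, MeasurableEquiv.piFinSuccAbove_apply, Fin.removeNth, Fin.insertNthEquiv,
      Equiv.coe_fn_symm_mk, e1, e2]
    congr 1
    ext l
    have e3 : (Matrix.toLin' M s) l = M l 0 * s 0 + M l 1 * s 1 + M l 2 * s 2 := by
      rw [Matrix.toLin'_apply]
      exact dot3 _ _
    simp only [PiLp.add_apply, PiLp.smul_apply, PiLp.sub_apply, smul_eq_mul, e3]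
    simp [hM]
    ring
  rw [h3, h2, h1, hdet, ← mul_assoc, mul_inv_cancel₀ (abs_ne_zero.2 hD), one_mul]

theorem bary_triPt (T : Finset E3) (v a b d : E3) (s : Fin 2 → ℝ) (z : ℝ) (p : E3) :
    bary T p (triPt v a b s + z • (d - v)) =
      bary T p v * (1 - s 0 - s 1 - z) + bary T p a * s 0 + bary T p b * s 1 + bary T p d * z := by
  simp only [triPt, bary_add_smul, bary_linear_sub]
  ring

theorem mem_interior_hull_triPt {T : Finset E3} {v a b d : E3} (h : Labeled T v a b d)
    (s : Fin 2 → ℝ) (z : ℝ) : triPt v a b s + z • (d - v) ∈ interior (hull T) ↔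
      0 < s 0 ∧ 0 < s 1 ∧ 0 < z ∧ s 0 + s 1 + z < 1 := by
  rw [mem_interior_hull_iff h.tet, h.forall_iff]
  simp only [bary_triPt, bary_self h.tet h.mem_v, bary_self h.tet h.mem_a,
    bary_self h.tet h.mem_b, bary_self h.tet h.mem_d, bary_ne h.tet h.mem_v h.va,
    bary_ne h.tet h.mem_v h.vb, bary_ne h.tet h.mem_v h.vd, bary_ne h.tet h.mem_a h.va.symm,
    bary_ne h.tet h.mem_a h.ab, bary_ne h.tet h.mem_a h.ad, bary_ne h.tet h.mem_b h.vb.symm,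
    bary_ne h.tet h.mem_b h.ab.symm, bary_ne h.tet h.mem_b h.bd, bary_ne h.tet h.mem_d h.vd.symm,
    bary_ne h.tet h.mem_d h.ad.symm, bary_ne h.tet h.mem_d h.bd.symm]
  constructor
  · rintro ⟨h1, h2, h3, h4⟩
    refine ⟨?_, ?_, ?_, ?_⟩ <;> linarith
  · rintro ⟨h1, h2, h3, h4⟩
    refine ⟨?_, ?_, ?_, ?_⟩ <;> linarith

theorem isCompact_hull (T : Finset E3) : IsCompact (hull T) :=
  T.finite_toSet.isCompact_convexHull (𝕜 := ℝ)

theorem integrableOn_interior_hull (T : Finset E3) {f : E3 → ℝ} (hf : Continuous f) :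
    IntegrableOn f (interior (hull T)) :=
  (hf.continuousOn.integrableOn_compact (isCompact_hull T)).mono_set interior_subset

/-- Fubini and the fundamental theorem of calculus on segments parallel to `d - v`. They start on
the facet `v a b` and end on the facet opposite `v`, where `f` vanishes. -/
theorem integral_tet_fderiv {T : Finset E3} {v a b d : E3} (h : Labeled T v a b d) {f : E3 → ℝ}
    (hf : ContDiff ℝ 1 f) (h0 : ∀ x, bary T v x = 0 → f x = 0) :
    ∫ x in interior (hull T), fderiv ℝ f x (d - v) = -(|vol6 v a b d| * triInt v a b f) := by
  have hfc : Continuous fun x => fderiv ℝ f x (d - v) :=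
    (hf.continuous_fderiv one_ne_zero).clm_apply continuous_const
  rw [← integral_indicator isOpen_interior.measurableSet, integral_E3_eq _ v a b d (vol6_ne_zero h),
    ← mul_neg]
  congr 1
  have hA : Continuous fun z : ℝ × (Fin 2 → ℝ) => triPt v a b z.2 + z.1 • (d - v) :=
    ((triPt_continuous v a b).comp continuous_snd).add (continuous_fst.smul continuous_const)
  set R : Set (ℝ × (Fin 2 → ℝ)) :=
    (fun z : ℝ × (Fin 2 → ℝ) => triPt v a b z.2 + z.1 • (d - v)) ⁻¹' interior (hull T) with hR
  have hRo : IsOpen R := isOpen_interior.preimage hA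
  have hRs : R ⊆ Set.Icc 0 1 ×ˢ Set.Icc 0 1 := by
    rintro ⟨z, s⟩ hz
    obtain ⟨h1, h2, h3, h4⟩ := (mem_interior_hull_triPt h s z).1 hz
    refine ⟨⟨h3.le, by simp only; linarith⟩, refTri_subset ⟨h1, h2, by linarith⟩⟩
  have hint : Integrable (fun z : ℝ × (Fin 2 → ℝ) =>
      (interior (hull T)).indicator (fun x => fderiv ℝ f x (d - v))
        (triPt v a b z.2 + z.1 • (d - v))) (volume.prod volume) := by
    have : IntegrableOn (fun z : ℝ × (Fin 2 → ℝ) =>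
        fderiv ℝ f (triPt v a b z.2 + z.1 • (d - v)) (d - v)) R (volume.prod volume) :=
      ((hfc.comp hA).continuousOn.integrableOn_compact
        (isCompact_Icc.prod isCompact_Icc)).mono_set hRs
    exact (integrable_indicator_iff hRo.measurableSet).2 this
  rw [Measure.volume_eq_prod, integral_prod_symm _ hint, triInt, ← integral_neg,
    ← integral_indicator isOpen_refTri.measurableSet]
  refine integral_congr_ae (Eventually.of_forall fun s => ?_)
  by_cases hs : s ∈ refTri
  · rw [Set.indicator_of_mem hs]
    have hs' := hs
    obtain ⟨h1, h2, h3⟩ := hs'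
    have e : (fun z : ℝ => (interior (hull T)).indicator (fun x => fderiv ℝ f x (d - v))
        (triPt v a b s + z • (d - v))) = (Set.Ioo 0 (1 - s 0 - s 1)).indicator
          (fun z => fderiv ℝ f (triPt v a b s + z • (d - v)) (d - v)) := by
      funext z
      by_cases hz : z ∈ Set.Ioo 0 (1 - s 0 - s 1)
      · rw [Set.indicator_of_mem hz, Set.indicator_of_mem]
        exact (mem_interior_hull_triPt h s z).2 ⟨h1, h2, hz.1, by linarith [hz.2]⟩
      · rw [Set.indicator_of_notMem hz, Set.indicator_of_notMem]
        intro hz'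
        obtain ⟨-, -, h5, h6⟩ := (mem_interior_hull_triPt h s z).1 hz'
        exact hz ⟨h5, by linarith⟩
    simp only
    rw [e, integral_indicator measurableSet_Ioo, ← integral_Ioc_eq_integral_Ioo,
      ← intervalIntegral.integral_of_le (by linarith)]
    have hd : ∀ z : ℝ, HasDerivAt (fun z : ℝ => f (triPt v a b s + z • (d - v)))
        (fderiv ℝ f (triPt v a b s + z • (d - v)) (d - v)) z := by
      intro z
      have h7 : HasDerivAt (fun z : ℝ => triPt v a b s + z • (d - v)) (d - v) z := by
        simpa using ((hasDerivAt_id z).smul_const (d - v)).const_add (triPt v a b s)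
      exact ((hf.differentiable one_ne_zero) _).hasFDerivAt.comp_hasDerivAt z h7
    rw [intervalIntegral.integral_eq_sub_of_hasDerivAt (fun z _ => hd z)
      ((hfc.comp (by fun_prop : Continuous fun z : ℝ => triPt v a b s + z • (d - v))).intervalIntegrable
        _ _)]
    -- The upper endpoint has zero coordinate at `v`, so only the endpoint on `v a b` contributes.
    rw [h0 (triPt v a b s + (1 - s 0 - s 1) • (d - v))]
    · simp
    · rw [bary_triPt, bary_self h.tet h.mem_v, bary_ne h.tet h.mem_a h.va.symm,
        bary_ne h.tet h.mem_b h.vb.symm, bary_ne h.tet h.mem_d h.vd.symm]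
      ring
  · rw [Set.indicator_of_notMem hs]
    have e : (fun z : ℝ => (interior (hull T)).indicator (fun x => fderiv ℝ f x (d - v))
        (triPt v a b s + z • (d - v))) = fun _ => 0 := by
      funext z
      rw [Set.indicator_of_notMem]
      intro hz'
      obtain ⟨h4, h5, h6, h7⟩ := (mem_interior_hull_triPt h s z).1 hz'
      exact hs ⟨h4, h5, by linarith⟩
    simp only
    rw [e, integral_zero]

/-! ### The divergence theorem for fields vanishing on two facets -/

/-- The divergence of a vector field. -/
noncomputable def vdiv (F : E3 → Fin 3 → ℝ) (x : E3) : ℝ := ∑ l, pgrad (fun y => F y l) x l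

/-- The orientation of the triangle `v a b` with respect to the tetrahedron `T`. -/
noncomputable def orient (v a b : E3) (T : Finset E3) : ℝ :=
  Real.sign (triNormal v a b ⬝ᵥ (∑ p ∈ T, (p - v)).ofLp)

theorem orient_eq {T : Finset E3} {v a b d : E3} (h : Labeled T v a b d) :
    orient v a b T = Real.sign (vol6 v a b d) := by
  rw [orient, h.sum_eq]
  congr 1
  simp only [vol6, triNormal, dot3, cross_zero', cross_one', cross_two', WithLp.ofLp_sub,
    Pi.sub_apply, WithLp.ofLp_add, Pi.add_apply]
  ring

theorem vol6_swap (v a b d : E3) : vol6 v a d b = - vol6 v a b d := by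
  simp only [vol6, triNormal, dot3, cross_zero', cross_one', cross_two', WithLp.ofLp_sub,
    Pi.sub_apply]
  ring

theorem fderiv_eq_sum_pgrad (f : E3 → ℝ) (x t : E3) :
    fderiv ℝ f x t = t 0 * pgrad f x 0 + t 1 * pgrad f x 1 + t 2 * pgrad f x 2 := by
  have h2 : t = ∑ l, t l • EuclideanSpace.single l (1 : ℝ) := by
    ext j; simp [Finset.sum_apply, Pi.single_apply]
  conv_lhs => rw [h2]
  simp [pgrad, Fin.sum_univ_three]

theorem continuous_pgrad {f : E3 → ℝ} (hf : ContDiff ℝ 1 f) (l : Fin 3) :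
    Continuous fun x => pgrad f x l :=
  (hf.continuous_fderiv one_ne_zero).clm_apply continuous_const

theorem pgrad_add {f g : E3 → ℝ} (hf : Differentiable ℝ f) (hg : Differentiable ℝ g) (x : E3)
    (l : Fin 3) : pgrad (fun y => f y + g y) x l = pgrad f x l + pgrad g x l := by
  simp only [pgrad, fderiv_fun_add (hf x) (hg x)]
  rfl

theorem pgrad_sub {f g : E3 → ℝ} (hf : Differentiable ℝ f) (hg : Differentiable ℝ g) (x : E3)
    (l : Fin 3) : pgrad (fun y => f y - g y) x l = pgrad f x l - pgrad g x l := by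
  simp only [pgrad, fderiv_fun_sub (hf x) (hg x)]
  rfl

theorem pgrad_mul {f g : E3 → ℝ} (hf : Differentiable ℝ f) (hg : Differentiable ℝ g) (x : E3)
    (l : Fin 3) : pgrad (fun y => f y * g y) x l = f x * pgrad g x l + g x * pgrad f x l := by
  simp only [pgrad, fderiv_fun_mul (hf x) (hg x)]
  rfl

theorem pgrad_mul_const {f : E3 → ℝ} (hf : Differentiable ℝ f) (c : ℝ) (x : E3)
    (l : Fin 3) : pgrad (fun y => f y * c) x l = c * pgrad f x l := by
  simp only [pgrad, fderiv_mul_const (hf x)]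
  rfl

theorem pgrad_const_mul {f : E3 → ℝ} (hf : Differentiable ℝ f) (c : ℝ) (x : E3)
    (l : Fin 3) : pgrad (fun y => c * f y) x l = c * pgrad f x l := by
  simp only [pgrad, fderiv_const_mul (hf x)]
  rfl

theorem pgrad_const (c : ℝ) (x : E3) (l : Fin 3) : pgrad (fun _ => c) x l = 0 := by
  simp [pgrad]

theorem pgrad_dot_const {F : E3 → Fin 3 → ℝ} (hF : ∀ l, ContDiff ℝ 1 fun x => F x l)
    (n : Fin 3 → ℝ) (x : E3) (l : Fin 3) :
    pgrad (fun y => F y ⬝ᵥ n) x l = n 0 * pgrad (fun y => F y 0) x l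
      + n 1 * pgrad (fun y => F y 1) x l + n 2 * pgrad (fun y => F y 2) x l := by
  have hd : ∀ l, Differentiable ℝ (fun y => F y l) := fun l => (hF l).differentiable one_ne_zero
  simp only [dot3]
  rw [pgrad_add (((hd 0).mul_const _).fun_add ((hd 1).mul_const _)) ((hd 2).mul_const _),
    pgrad_add ((hd 0).mul_const _) ((hd 1).mul_const _), pgrad_mul_const (hd 0),
    pgrad_mul_const (hd 1), pgrad_mul_const (hd 2)]

theorem contDiff_dot_const {F : E3 → Fin 3 → ℝ} (hF : ∀ l, ContDiff ℝ 1 fun x => F x l)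
    (n : Fin 3 → ℝ) : ContDiff ℝ 1 fun x => F x ⬝ᵥ n := by
  simp only [dot3]
  have := hF 0
  have := hF 1
  have := hF 2
  fun_prop

/-- The divergence is the trace of the derivative, computed in the basis of edges at `v`; the facet
normals are its dual basis up to sign and the factor `vol6`. -/
theorem vol6_mul_vdiv (v a b d : E3) {F : E3 → Fin 3 → ℝ}
    (hF : ∀ l, ContDiff ℝ 1 fun x => F x l) (x : E3) :
    vol6 v a b d * vdiv F x = fderiv ℝ (fun y => F y ⬝ᵥ triNormal v b d) x (a - v)
      - fderiv ℝ (fun y => F y ⬝ᵥ triNormal v a d) x (b - v)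
      + fderiv ℝ (fun y => F y ⬝ᵥ triNormal v a b) x (d - v) := by
  simp only [fderiv_eq_sum_pgrad, pgrad_dot_const hF, vdiv, Fin.sum_univ_three]
  simp only [vol6, triNormal, dot3, cross_zero', cross_one', cross_two', WithLp.ofLp_sub,
    Pi.sub_apply, PiLp.sub_apply]
  ring

theorem bary_triPt_facet {T : Finset E3} {v a b d : E3} (h : Labeled T v a b d) (s : Fin 2 → ℝ) :
    bary T d (triPt v a b s) = 0 := by
  have := bary_triPt T v a b d s 0 d
  rw [bary_ne h.tet h.mem_v h.vd, bary_ne h.tet h.mem_a h.ad, bary_ne h.tet h.mem_b h.bd] at this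
  simpa using this

/-- With zero flux through the facets opposite `v` and `a`, only the two facets containing the edge
`v a` remain. This case of the divergence theorem reduces to three directional integrals. -/
theorem integral_tet_vdiv {T : Finset E3} {v a b d : E3} (h : Labeled T v a b d)
    {F : E3 → Fin 3 → ℝ} (hF : ∀ l, ContDiff ℝ 1 fun x => F x l)
    (hv : ∀ x, bary T v x = 0 → F x = 0) (ha : ∀ x, bary T a x = 0 → F x = 0) :
    ∫ x in interior (hull T), vdiv F x =
      -(orient v a b T * triInt v a b (fun x => F x ⬝ᵥ triNormal v a b)
        + orient v a d T * triInt v a d (fun x => F x ⬝ᵥ triNormal v a d)) := by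
  have hD := vol6_ne_zero h
  have hc : ∀ n : Fin 3 → ℝ, ContDiff ℝ 1 fun x => F x ⬝ᵥ n := contDiff_dot_const hF
  have hz : ∀ n : Fin 3 → ℝ, ∀ x, bary T v x = 0 → F x ⬝ᵥ n = 0 := fun n x hx => by
    simp [hv x hx]
  have hi : ∀ n : Fin 3 → ℝ, ∀ t : E3,
      IntegrableOn (fun x => fderiv ℝ (fun y => F y ⬝ᵥ n) x t) (interior (hull T)) := fun n t =>
    integrableOn_interior_hull T
      (((hc n).continuous_fderiv one_ne_zero).clm_apply continuous_const)
  have e1 := integral_tet_fderiv h.rotate (hc (triNormal v b d)) (hz _)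
  have e2 := integral_tet_fderiv h.swap (hc (triNormal v a d)) (hz _)
  have e3 := integral_tet_fderiv h (hc (triNormal v a b)) (hz _)
  have e4 : triInt v b d (fun x => F x ⬝ᵥ triNormal v b d) = 0 := by
    rw [triInt_congr (g := fun _ => 0)]
    · simp [triInt]
    · intro s _
      simp [ha _ (bary_triPt_facet h.rotate s)]
  have key : vol6 v a b d * ∫ x in interior (hull T), vdiv F x =
      |vol6 v a b d| * (triInt v a d (fun x => F x ⬝ᵥ triNormal v a d)
        - triInt v a b (fun x => F x ⬝ᵥ triNormal v a b)) := by
    rw [← integral_const_mul]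
    simp only [vol6_mul_vdiv v a b d hF]
    have h12 : IntegrableOn (fun x => fderiv ℝ (fun y => F y ⬝ᵥ triNormal v b d) x (a - v)
        - fderiv ℝ (fun y => F y ⬝ᵥ triNormal v a d) x (b - v)) (interior (hull T)) :=
      (hi _ _).sub (hi _ _)
    rw [integral_add h12 (hi _ _), integral_sub (hi _ _) (hi _ _), e1, e2, e3, e4, vol6_swap v a b d, abs_neg]
    ring
  rw [orient_eq h, orient_eq h.swap, vol6_swap v a b d, Real.sign_neg]
  rcases hD.lt_or_gt with hD' | hD'
  · rw [Real.sign_of_neg hD']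
    rw [abs_of_neg hD'] at key
    have := mul_left_cancel₀ hD (key.trans (neg_mul_comm _ _))
    rw [this]; ring
  · rw [Real.sign_of_pos hD']
    rw [abs_of_pos hD'] at key
    rw [mul_left_cancel₀ hD key]; ring

/-! ### Geometry of the mesh -/

section Mesh

variable {K : Geometry.SimplicialComplex ℝ E3}

theorem isTet_of_mem_cells {T : Finset E3} (hT : T ∈ cells K) : IsTet T :=
  ⟨hT.2, K.indep hT.1⟩

/-- The finite set of tetrahedra of a mesh. -/
noncomputable def IsTetMesh.cellFinset (hK : IsTetMesh K) : Finset (Finset E3) :=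
  (hK.finite.subset fun _ hT => hT.1 : (cells K).Finite).toFinset

theorem IsTetMesh.mem_cellFinset (hK : IsTetMesh K) {T : Finset E3} :
    T ∈ hK.cellFinset ↔ T ∈ cells K := by
  simp [IsTetMesh.cellFinset]

/-- Two simplices of the complex meet in the hull of their common vertices, where the coordinate at
any other vertex vanishes. -/
theorem bary_eq_zero_of_mem_hull {S T : Finset E3} (hS : S ∈ cells K) (hT : T ∈ cells K) {x p : E3}
    (hxS : x ∈ hull S) (hxT : x ∈ hull T) (hpS : p ∉ S) : bary T p x = 0 := by
  have h1 := K.inter_subset_convexHull hS.1 hT.1 ⟨hxS, hxT⟩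
  have h2 : Convex ℝ {x | bary T p x = 0} :=
    (convex_singleton (0 : ℝ)).affine_preimage (bary T p)
  refine convexHull_min (fun y hy => ?_) h2 h1
  exact bary_ne (isTet_of_mem_cells hT) hy.2 fun h => hpS (h ▸ hy.1)

theorem mem_of_bary_pos {S T : Finset E3} (hS : S ∈ cells K) (hT : T ∈ cells K) {x p : E3}
    (hxS : x ∈ hull S) (hxT : x ∈ hull T) (hp : 0 < bary T p x) : p ∈ S := by
  by_contra h
  exact hp.ne' (bary_eq_zero_of_mem_hull hS hT hxS hxT h)

theorem cell_eq_of_mem_interior {S T : Finset E3} (hS : S ∈ cells K) (hT : T ∈ cells K) {x : E3}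
    (hxS : x ∈ hull S) (hxT : x ∈ interior (hull T)) : T = S := by
  refine Finset.eq_of_subset_of_card_le (fun p hp => ?_) (by rw [hS.2, hT.2])
  exact mem_of_bary_pos hS hT hxS (interior_subset hxT)
    ((mem_interior_hull_iff (isTet_of_mem_cells hT)).1 hxT p hp)

theorem IsTetMesh.mem_space_iff (hK : IsTetMesh K) {x : E3} :
    x ∈ K.space ↔ ∃ T ∈ cells K, x ∈ hull T := by
  rw [Geometry.SimplicialComplex.mem_space_iff]
  constructor
  · rintro ⟨s, hs, hx⟩
    obtain ⟨T, hT, hsT, hc⟩ := hK.pure s hs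
    exact ⟨T, ⟨hT, hc⟩, convexHull_mono (by exact_mod_cast hsT) hx⟩
  · rintro ⟨T, hT, hx⟩
    exact ⟨T, hT.1, hx⟩

theorem interior_hull_subset_domain {T : Finset E3} (hT : T ∈ cells K) :
    interior (hull T) ⊆ domain K :=
  interior_mono (Geometry.SimplicialComplex.convexHull_subset_space hT.1)

/-- What is lost lies in the frontiers of finitely many convex sets, which are null. -/
theorem IsTetMesh.domain_ae_eq (hK : IsTetMesh K) :
    (domain K : Set E3) =ᵐ[volume] ⋃ T ∈ hK.cellFinset, interior (hull T) := by
  have h1 : (⋃ T ∈ hK.cellFinset, interior (hull T)) ⊆ domain K :=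
    Set.iUnion₂_subset fun T hT => interior_hull_subset_domain (hK.mem_cellFinset.1 hT)
  have h2 : (domain K : Set E3) ⊆
      (⋃ T ∈ hK.cellFinset, interior (hull T)) ∪ ⋃ T ∈ hK.cellFinset, frontier (hull T) := by
    intro x hx
    obtain ⟨T, hT, hxT⟩ := hK.mem_space_iff.1 (interior_subset hx)
    have hT' := hK.mem_cellFinset.2 hT
    by_cases h : x ∈ interior (hull T)
    · exact Or.inl (Set.mem_biUnion hT' h)
    · exact Or.inr (Set.mem_biUnion hT' ⟨subset_closure hxT, h⟩)
  have h3 : volume (⋃ T ∈ hK.cellFinset, frontier (hull T)) = 0 :=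
    (measure_biUnion_null_iff hK.cellFinset.countable_toSet).2 fun T _ =>
      (convex_convexHull ℝ _).addHaar_frontier volume
  refine (ae_le_set.2 ?_).antisymm h1.eventuallyLE
  refine measure_mono_null ?_ h3
  rintro x ⟨hx, hx'⟩
  exact (h2 hx).resolve_left hx'

theorem IsTetMesh.integral_domain (hK : IsTetMesh K) {f : E3 → ℝ}
    (hf : ∀ T ∈ cells K, IntegrableOn f (interior (hull T))) :
    ∫ x in domain K, f x = ∑ T ∈ hK.cellFinset, ∫ x in interior (hull T), f x := by
  rw [setIntegral_congr_set hK.domain_ae_eq]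
  refine integral_biUnion_finset _ (fun T _ => isOpen_interior.measurableSet) ?_
    fun T hT => hf T (hK.mem_cellFinset.1 hT)
  intro S hS T hT hST
  refine Set.disjoint_left.2 fun x hx hx' => hST ?_
  exact (cell_eq_of_mem_interior (hK.mem_cellFinset.1 hS) (hK.mem_cellFinset.1 hT)
    (interior_subset hx) hx').symm

/-- Distinct cells with a common facet lie on opposite sides of it. Otherwise, moving the centroid
of the facet slightly towards `d` would enter both interiors. -/
theorem vol6_mul_neg {T T' : Finset E3} (hT : T ∈ cells K) (hT' : T' ∈ cells K) (hne : T ≠ T')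
    {v a b d d' : E3} (h : Labeled T v a b d) (h' : Labeled T' v a b d') :
    vol6 v a b d * vol6 v a b d' < 0 := by
  by_contra hcon
  have hpos : 0 < vol6 v a b d * vol6 v a b d' :=
    lt_of_le_of_ne (not_lt.1 hcon) (mul_ne_zero (vol6_ne_zero h) (vol6_ne_zero h')).symm
  set x : ℝ → E3 := fun ε => triPt v a b (fun _ => 1 / 3) + ε • (d - v) with hx
  have hxc : Continuous x := by fun_prop
  have h1 : ∀ p ∈ T', p ≠ d' → ∀ᶠ ε in 𝓝[>] (0 : ℝ), 0 < bary T' p (x ε) := by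
    intro p hp hpd
    have hc : Continuous fun ε => bary T' p (x ε) := (bary_continuous T' p).comp hxc
    refine (hc.tendsto 0).eventually_const_lt ?_ |>.filter_mono nhdsWithin_le_nhds
    have e := bary_triPt T' v a b d' (fun _ => 1 / 3) 0 p
    have e0 : x 0 = triPt v a b (fun _ => 1 / 3) + (0 : ℝ) • (d' - v) := by simp [hx]
    rw [e0, e]
    rcases (h'.mem_iff p).1 hp with rfl | rfl | rfl | rfl
    · rw [bary_self h'.tet hp, bary_ne h'.tet h'.mem_a h'.va.symm,
        bary_ne h'.tet h'.mem_b h'.vb.symm]; norm_num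
    · rw [bary_self h'.tet hp, bary_ne h'.tet h'.mem_v h'.va,
        bary_ne h'.tet h'.mem_b h'.ab.symm]; norm_num
    · rw [bary_self h'.tet hp, bary_ne h'.tet h'.mem_v h'.vb,
        bary_ne h'.tet h'.mem_a h'.ab]; norm_num
    · exact absurd rfl hpd
  have h2 : ∀ ε : ℝ, 0 < ε → 0 < bary T' d' (x ε) := by
    intro ε hε
    have e1 := bary_mul_vol6 h (x ε)
    have e2 := bary_mul_vol6 h' (x ε)
    have e3 : bary T d (x ε) = ε := by
      rw [hx, bary_triPt, bary_ne h.tet h.mem_v h.vd, bary_ne h.tet h.mem_a h.ad,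
        bary_ne h.tet h.mem_b h.bd, bary_self h.tet h.mem_d]
      ring
    rw [e3] at e1
    have e4 : bary T' d' (x ε) * (vol6 v a b d') ^ 2 = ε * (vol6 v a b d * vol6 v a b d') := by
      rw [sq, ← mul_assoc, e2, ← e1]; ring
    have e5 : 0 < (vol6 v a b d') ^ 2 := by have := vol6_ne_zero h'; positivity
    exact pos_of_mul_pos_left (e4 ▸ mul_pos hε hpos) e5.le
  have h3 : ∀ᶠ ε in 𝓝[>] (0 : ℝ), ε < 1 / 3 :=
    (eventually_lt_nhds (by norm_num)).filter_mono nhdsWithin_le_nhds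
  obtain ⟨ε, hv, ha, hb, hε3, hε⟩ := ((h1 v h'.mem_v h'.vd).and ((h1 a h'.mem_a h'.ad).and
    ((h1 b h'.mem_b h'.bd).and (h3.and self_mem_nhdsWithin)))).exists
  have m1 : x ε ∈ interior (hull T) := by
    refine (mem_interior_hull_triPt h _ _).2 ⟨by norm_num, by norm_num, hε, by linarith⟩
  have m2 : x ε ∈ interior (hull T') := by
    rw [mem_interior_hull_iff h'.tet, h'.forall_iff]
    exact ⟨hv, ha, hb, h2 ε hε⟩
  exact hne (cell_eq_of_mem_interior hT' hT (interior_subset m2) m1)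

theorem orient_add_orient {T T' : Finset E3} (hT : T ∈ cells K) (hT' : T' ∈ cells K) (hne : T ≠ T')
    {v a b d d' : E3} (h : Labeled T v a b d) (h' : Labeled T' v a b d') :
    orient v a b T' = - orient v a b T := by
  rw [orient_eq h, orient_eq h']
  rcases mul_neg_iff.1 (vol6_mul_neg hT hT' hne h h') with ⟨h1, h2⟩ | ⟨h1, h2⟩
  · rw [Real.sign_of_neg h2, Real.sign_of_pos h1]
  · rw [Real.sign_of_neg h1, Real.sign_of_pos h2, neg_neg]

/-- Three nonzero signed volumes cannot have pairwise opposite signs, so a facet lies in at most two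
cells. -/
theorem cell_eq_or_eq_of_facet {T T' S : Finset E3} (hT : T ∈ cells K) (hT' : T' ∈ cells K)
    (hS : S ∈ cells K) (hne : T ≠ T') {v a b d d' e : E3} (h : Labeled T v a b d)
    (h' : Labeled T' v a b d') (hs : Labeled S v a b e) : S = T ∨ S = T' := by
  by_contra! hcon
  have h1 := vol6_mul_neg hT hT' hne h h'
  have h2 := vol6_mul_neg hT hS hcon.1.symm h hs
  have h3 := vol6_mul_neg hT' hS hcon.2.symm h' hs
  nlinarith [mul_pos_of_neg_of_neg h1 h2, sq_nonneg (vol6 v a b d)]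

theorem bary_triPt_pos {T : Finset E3} {v a b d : E3} (h : Labeled T v a b d) {s : Fin 2 → ℝ}
    (hs : s ∈ refTri) {p : E3} (hp : p = v ∨ p = a ∨ p = b) : 0 < bary T p (triPt v a b s) := by
  have e := bary_triPt T v a b d s 0 p
  rw [zero_smul, add_zero] at e
  obtain ⟨h0, h1, h2⟩ := hs
  rw [e]
  rcases hp with rfl | rfl | rfl
  · rw [bary_self h.tet h.mem_v, bary_ne h.tet h.mem_a h.va.symm,
      bary_ne h.tet h.mem_b h.vb.symm]; linarith
  · rw [bary_self h.tet h.mem_a, bary_ne h.tet h.mem_v h.va,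
      bary_ne h.tet h.mem_b h.ab.symm]; linarith
  · rw [bary_self h.tet h.mem_b, bary_ne h.tet h.mem_v h.vb,
      bary_ne h.tet h.mem_a h.ab]; linarith

theorem triPt_mem_hull {T : Finset E3} {v a b d : E3} (h : Labeled T v a b d) {s : Fin 2 → ℝ}
    (hs : s ∈ refTri) : triPt v a b s ∈ hull T := by
  rw [mem_hull_iff h.tet, h.forall_iff]
  exact ⟨(bary_triPt_pos h hs (by simp)).le, (bary_triPt_pos h hs (by simp)).le,
    (bary_triPt_pos h hs (by simp)).le, (bary_triPt_facet h s).ge⟩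

/-- Crossing an unshared facet away from `d` leaves `T` and enters no other cell. This is how test
functions on the domain come to vanish on boundary facets. -/
theorem IsTetMesh.triPt_notMem_domain (hK : IsTetMesh K) {T : Finset E3} (hT : T ∈ cells K)
    {v a b d : E3} (h : Labeled T v a b d)
    (huniq : ∀ S ∈ cells K, v ∈ S → a ∈ S → b ∈ S → S = T) {s : Fin 2 → ℝ} (hs : s ∈ refTri) :
    triPt v a b s ∉ domain K := by
  intro hmem
  set x : ℝ → E3 := fun ε => triPt v a b s + ε • (d - v) with hx
  have hxc : Continuous x := by fun_prop
  have hx0 : x 0 = triPt v a b s := by simp [hx]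
  have h1 : ∀ S ∈ hK.cellFinset.erase T, ∀ᶠ ε in 𝓝 (0 : ℝ), x ε ∉ hull S := by
    intro S hS
    obtain ⟨hST, hS⟩ := Finset.mem_erase.1 hS
    have hS := hK.mem_cellFinset.1 hS
    have hc : IsOpen (hull S)ᶜ := (isCompact_hull S).isClosed.isOpen_compl
    refine hxc.continuousAt.eventually_mem (hc.mem_nhds ?_)
    rw [hx0]
    intro hxS
    have hxT := triPt_mem_hull h hs
    exact hST (huniq S hS (mem_of_bary_pos hS hT hxS hxT (bary_triPt_pos h hs (by simp)))
      (mem_of_bary_pos hS hT hxS hxT (bary_triPt_pos h hs (by simp)))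
      (mem_of_bary_pos hS hT hxS hxT (bary_triPt_pos h hs (by simp))))
  have h2 : ∀ᶠ ε in 𝓝 (0 : ℝ), x ε ∈ domain K :=
    hxc.continuousAt.eventually_mem (isOpen_interior.mem_nhds (by rwa [hx0]))
  have h3 := (((Finset.eventually_all _).2 h1).and h2).filter_mono
    (nhdsWithin_le_nhds (s := Set.Iio 0))
  obtain ⟨ε, ⟨h4, h5⟩, h6⟩ := (h3.and self_mem_nhdsWithin).exists
  obtain ⟨S, hS, hxS⟩ := hK.mem_space_iff.1 (interior_subset h5)
  have hST : S = T := by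
    by_contra hne
    exact h4 S (Finset.mem_erase.2 ⟨hne, hK.mem_cellFinset.2 hS⟩) hxS
  subst hST
  have h7 := (mem_hull_iff h.tet).1 hxS d h.mem_d
  rw [hx, bary_triPt, bary_ne h.tet h.mem_v h.vd, bary_ne h.tet h.mem_a h.ad,
    bary_ne h.tet h.mem_b h.bd, bary_self h.tet h.mem_d] at h7
  have h8 : ε < 0 := h6
  linarith

end Mesh

/-! ### Piecewise defined functions -/

section Piecewise

variable {K : Geometry.SimplicialComplex ℝ E3}

/-- The function equal to `G T` in the interior of the tetrahedra `T ∈ S` and zero elsewhere. -/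
noncomputable def pw (S : Finset (Finset E3)) (G : Finset E3 → E3 → ℝ) (x : E3) : ℝ :=
  ∑ T ∈ S, (interior (hull T)).indicator (G T) x

theorem pw_of_mem {S : Finset (Finset E3)} (hS : ∀ T ∈ S, T ∈ cells K) (G : Finset E3 → E3 → ℝ)
    {T : Finset E3} (hT : T ∈ S) {x : E3} (hx : x ∈ interior (hull T)) : pw S G x = G T x := by
  rw [pw, Finset.sum_eq_single T, Set.indicator_of_mem hx]
  · intro T' hT' hne
    refine Set.indicator_of_notMem (fun hx' => hne ?_) _
    exact cell_eq_of_mem_interior (hS T hT) (hS T' hT') (interior_subset hx) hx'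
  · exact fun h => absurd hT h

theorem pw_of_notMem {S : Finset (Finset E3)} (hS : ∀ T ∈ S, T ∈ cells K)
    (G : Finset E3 → E3 → ℝ) {T : Finset E3} (hTK : T ∈ cells K) (hT : T ∉ S) {x : E3}
    (hx : x ∈ interior (hull T)) : pw S G x = 0 := by
  refine Finset.sum_eq_zero fun T' hT' => Set.indicator_of_notMem (fun hx' => hT ?_) _
  rwa [← cell_eq_of_mem_interior hTK (hS T' hT') (interior_subset hx) hx']

theorem memLp_pw (S : Finset (Finset E3)) {G : Finset E3 → E3 → ℝ} (hG : ∀ T, Continuous (G T))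
    (Ω : Set E3) : MemLp (pw S G) 2 (volume.restrict Ω) := by
  refine MemLp.restrict _ ?_
  have : pw S G = ∑ T ∈ S, (interior (hull T)).indicator (G T) := by
    funext x; simp [pw]
  rw [this]
  refine memLp_finsetSum' _ fun T _ => ?_
  rw [memLp_indicator_iff_restrict isOpen_interior.measurableSet]
  have hlt : volume (interior (hull T)) < ⊤ :=
    (measure_mono interior_subset).trans_lt (isCompact_hull T).measure_lt_top
  have : IsFiniteMeasure (volume.restrict (interior (hull T))) := ⟨by simpa using hlt⟩
  obtain ⟨C, hC⟩ := (isCompact_hull T).exists_bound_of_continuousOn (hG T).continuousOn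
  refine MemLp.of_bound (hG T).aestronglyMeasurable C ?_
  exact (ae_restrict_iff' isOpen_interior.measurableSet).2
    (Eventually.of_forall fun x hx => hC x (interior_subset hx))

/-- The tetrahedra of the mesh that contain the edge `v a`. -/
noncomputable def IsTetMesh.star (hK : IsTetMesh K) (v a : E3) : Finset (Finset E3) :=
  hK.cellFinset.filter fun T => v ∈ T ∧ a ∈ T

theorem IsTetMesh.mem_star (hK : IsTetMesh K) {v a : E3} {T : Finset E3} :
    T ∈ hK.star v a ↔ T ∈ cells K ∧ v ∈ T ∧ a ∈ T := by
  simp [IsTetMesh.star, hK.mem_cellFinset]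

/-- An integral over the domain of a function supported in the star of an edge. -/
theorem IsTetMesh.integral_star (hK : IsTetMesh K) {v a : E3} {f : E3 → ℝ}
    {G : Finset E3 → E3 → ℝ} (hG : ∀ T, Continuous (G T))
    (h1 : ∀ T ∈ hK.star v a, ∀ x ∈ interior (hull T), f x = G T x)
    (h0 : ∀ T ∈ cells K, T ∉ hK.star v a → ∀ x ∈ interior (hull T), f x = 0) :
    ∫ x in domain K, f x = ∑ T ∈ hK.star v a, ∫ x in interior (hull T), G T x := by
  rw [hK.integral_domain, ← Finset.sum_subset (Finset.filter_subset _ _ : hK.star v a ⊆ _)]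
  · exact Finset.sum_congr rfl fun T hT =>
      setIntegral_congr_fun isOpen_interior.measurableSet (h1 T hT)
  · intro T hT hT'
    rw [setIntegral_congr_fun isOpen_interior.measurableSet
      (h0 T (hK.mem_cellFinset.1 hT) hT'), integral_zero]
  · intro T hT
    by_cases hT' : T ∈ hK.star v a
    · exact (integrableOn_interior_hull T (hG T)).congr_fun (fun x hx => (h1 T hT' x hx).symm)
        isOpen_interior.measurableSet
    · exact integrableOn_zero.congr_fun (fun x hx => (h0 T hT hT' x hx).symm)
        isOpen_interior.measurableSet

/-! ### Cancellation of facet contributions -/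

/-- At most two cells contain the facet. If there are two, equal values of `Θ` cancel by opposite
orientation; if there is one, `Θ` vanishes by `hbd`. -/
theorem IsTetMesh.sum_facet_eq_zero (hK : IsTetMesh K) {v a b : E3} (hva : v ≠ a) (hvb : v ≠ b)
    (hab : a ≠ b) {Θ : Finset E3 → ℝ}
    (hint : ∀ T ∈ hK.star v a, ∀ T' ∈ hK.star v a, T ≠ T' → b ∈ T → b ∈ T' → Θ T = Θ T')
    (hbd : ∀ T ∈ hK.star v a, b ∈ T → (∀ S ∈ cells K, v ∈ S → a ∈ S → b ∈ S → S = T) → Θ T = 0) :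
    ∑ T ∈ hK.star v a with b ∈ T, orient v a b T * Θ T = 0 := by
  classical
  by_cases hne : ((hK.star v a).filter fun T => b ∈ T).Nonempty
  swap
  · rw [Finset.not_nonempty_iff_eq_empty.1 hne, Finset.sum_empty]
  obtain ⟨T, hT⟩ := hne
  obtain ⟨hTs, hbT⟩ := Finset.mem_filter.1 hT
  obtain ⟨hTK, hvT, haT⟩ := hK.mem_star.1 hTs
  by_cases hex : ∃ T' ∈ hK.star v a, b ∈ T' ∧ T ≠ T'
  · obtain ⟨T', hTs', hbT', hne⟩ := hex
    obtain ⟨hTK', hvT', haT'⟩ := hK.mem_star.1 hTs'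
    obtain ⟨d, hd⟩ := (isTet_of_mem_cells hTK).exists_labeled_of_three hvT haT hbT hva hvb hab
    obtain ⟨d', hd'⟩ := (isTet_of_mem_cells hTK').exists_labeled_of_three hvT' haT' hbT' hva hvb hab
    have : ((hK.star v a).filter fun T => b ∈ T) = {T, T'} := by
      ext S
      simp only [Finset.mem_filter, Finset.mem_insert, Finset.mem_singleton]
      constructor
      · rintro ⟨hS, hbS⟩
        obtain ⟨hSK, hvS, haS⟩ := hK.mem_star.1 hS
        obtain ⟨e, he⟩ := (isTet_of_mem_cells hSK).exists_labeled_of_three hvS haS hbS hva hvb hab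
        exact cell_eq_or_eq_of_facet hTK hTK' hSK hne hd hd' he
      · rintro (rfl | rfl)
        exacts [⟨hTs, hbT⟩, ⟨hTs', hbT'⟩]
    rw [this, Finset.sum_pair hne, orient_add_orient hTK hTK' hne hd hd',
      hint T hTs T' hTs' hne hbT hbT']
    ring
  · push Not at hex
    refine Finset.sum_eq_zero fun S hS => ?_
    obtain ⟨hSs, hbS⟩ := Finset.mem_filter.1 hS
    have : T = S := hex S hSs hbS
    subst this
    rw [hbd T hTs hbT, mul_zero]
    intro S hSK h1 h2 h3
    exact (hex S (hK.mem_star.2 ⟨hSK, h1, h2⟩) h3).symm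

/-- The sum over the star of an edge of the boundary contributions of fields that vanish on the
facets not containing the edge, rearranged by facets. -/
theorem IsTetMesh.sum_star_integral_vdiv (hK : IsTetMesh K) {v a : E3} (hva : v ≠ a)
    {Z : Finset E3 → E3 → Fin 3 → ℝ} (hZ : ∀ T l, ContDiff ℝ 1 fun x => Z T x l)
    (hv : ∀ T ∈ hK.star v a, ∀ x, bary T v x = 0 → Z T x = 0)
    (ha : ∀ T ∈ hK.star v a, ∀ x, bary T a x = 0 → Z T x = 0) :
    ∑ T ∈ hK.star v a, ∫ x in interior (hull T), vdiv (Z T) x =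
      - ∑ b ∈ ((hK.star v a).biUnion id).filter fun b => v ≠ b ∧ a ≠ b,
        ∑ T ∈ hK.star v a with b ∈ T,
          orient v a b T * triInt v a b (fun x => Z T x ⬝ᵥ triNormal v a b) := by
  classical
  have h1 : ∀ T ∈ hK.star v a, ∫ x in interior (hull T), vdiv (Z T) x =
      - ∑ b ∈ T with v ≠ b ∧ a ≠ b,
        orient v a b T * triInt v a b (fun x => Z T x ⬝ᵥ triNormal v a b) := by
    intro T hT
    obtain ⟨hTK, hvT, haT⟩ := hK.mem_star.1 hT
    obtain ⟨b, d, h⟩ := (isTet_of_mem_cells hTK).exists_labeled_of_two hvT haT hva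
    rw [integral_tet_vdiv h (hZ T) (hv T hT) (ha T hT), Finset.sum_filter, h.sum_eq]
    simp [h.va, h.vb, h.vd, h.ab, h.ad]
  rw [Finset.sum_congr rfl h1, Finset.sum_neg_distrib]
  congr 1
  refine Finset.sum_comm' fun T b => ?_
  simp only [Finset.mem_filter, Finset.mem_biUnion, id]
  constructor
  · rintro ⟨h1, h2, h3⟩
    exact ⟨⟨h1, h2⟩, ⟨T, h1, h2⟩, h3⟩
  · rintro ⟨⟨h1, h2⟩, -, h3⟩
    exact ⟨h1, h2, h3⟩

theorem IsTetMesh.sum_star_integral_vdiv_eq_zero (hK : IsTetMesh K) {v a : E3} (hva : v ≠ a)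
    {Z : Finset E3 → E3 → Fin 3 → ℝ} (hZ : ∀ T l, ContDiff ℝ 1 fun x => Z T x l)
    (hv : ∀ T ∈ hK.star v a, ∀ x, bary T v x = 0 → Z T x = 0)
    (ha : ∀ T ∈ hK.star v a, ∀ x, bary T a x = 0 → Z T x = 0)
    (hint : ∀ T ∈ hK.star v a, ∀ T' ∈ hK.star v a, T ≠ T' → ∀ b, v ≠ b → a ≠ b → b ∈ T → b ∈ T' →
      ∀ s ∈ refTri, Z T (triPt v a b s) ⬝ᵥ triNormal v a b =
        Z T' (triPt v a b s) ⬝ᵥ triNormal v a b)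
    (hbd : ∀ T ∈ hK.star v a, ∀ x ∉ domain K, Z T x = 0) :
    ∑ T ∈ hK.star v a, ∫ x in interior (hull T), vdiv (Z T) x = 0 := by
  rw [hK.sum_star_integral_vdiv hva hZ hv ha, neg_eq_zero]
  refine Finset.sum_eq_zero fun b hb => ?_
  obtain ⟨hvb, hab⟩ := (Finset.mem_filter.1 hb).2
  refine hK.sum_facet_eq_zero hva hvb hab
    (Θ := fun T => triInt v a b (fun x => Z T x ⬝ᵥ triNormal v a b)) ?_ ?_
  · intro T hT T' hT' hne hbT hbT'
    exact triInt_congr (hint T hT T' hT' hne b hvb hab hbT hbT')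
  · intro T hT hbT huniq
    obtain ⟨hTK, hvT, haT⟩ := hK.mem_star.1 hT
    obtain ⟨d, hd⟩ := (isTet_of_mem_cells hTK).exists_labeled_of_three hvT haT hbT hva hvb hab
    have : triInt v a b (fun x => Z T x ⬝ᵥ triNormal v a b) = triInt v a b fun _ => 0 :=
      triInt_congr fun s hs => by
        rw [hbd T hT _ (hK.triPt_notMem_domain hTK hd huniq hs), zero_dotProduct]
    exact this.trans (by simp [triInt])

end Piecewise

/-! ### Test fields supported in the star of an edge -/

/-- The curl of a vector field. -/
noncomputable def vcurl (F : E3 → Fin 3 → ℝ) (x : E3) : Fin 3 → ℝ :=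
  ![pgrad (fun y => F y 2) x 1 - pgrad (fun y => F y 1) x 2,
    pgrad (fun y => F y 0) x 2 - pgrad (fun y => F y 2) x 0,
    pgrad (fun y => F y 1) x 0 - pgrad (fun y => F y 0) x 1]

theorem continuous_vcurl {F : E3 → Fin 3 → ℝ} (hF : ∀ l, ContDiff ℝ 1 fun x => F x l) (j : Fin 3) :
    Continuous fun x => vcurl F x j := by
  have h : ∀ l k, Continuous fun x => pgrad (fun y => F y l) x k := fun l k =>
    continuous_pgrad (hF l) k
  fin_cases j
  · exact (h 2 1).sub (h 1 2)
  · exact (h 0 2).sub (h 2 0)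
  · exact (h 1 0).sub (h 0 1)

theorem cross_cyclic (u w : Fin 3 → ℝ) (j : Fin 3) :
    (u ⨯₃ w) j = u (j + 1) * w (j + 2) - u (j + 2) * w (j + 1) := by
  fin_cases j
  · exact cross_zero' u w
  · exact cross_one' u w
  · exact cross_two' u w

theorem continuous_cross {F G : E3 → Fin 3 → ℝ} (hF : ∀ l, Continuous fun x => F x l)
    (hG : ∀ l, Continuous fun x => G x l) (j : Fin 3) : Continuous fun x => (F x ⨯₃ G x) j := by
  simp only [cross_cyclic]
  exact ((hF _).mul (hG _)).sub ((hF _).mul (hG _))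

theorem contDiff_cross {F G : E3 → Fin 3 → ℝ} (hF : ∀ l, ContDiff ℝ 1 fun x => F x l)
    (hG : ∀ l, ContDiff ℝ 1 fun x => G x l) (j : Fin 3) :
    ContDiff ℝ 1 fun x => (F x ⨯₃ G x) j := by
  simp only [cross_cyclic]
  exact ((hF _).mul (hG _)).sub ((hF _).mul (hG _))

theorem vdiv_smul_cross {φ : E3 → ℝ} {F : E3 → Fin 3 → ℝ} (hφ : ContDiff ℝ 1 φ)
    (hF : ∀ l, ContDiff ℝ 1 fun x => F x l) (j : Fin 3) (x : E3) :
    vdiv (fun y => (φ y • F y) ⨯₃ Pi.single j 1) x =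
      vcurl F x j * φ x + (pgrad φ x ⨯₃ F x) j := by
  have dφ := hφ.differentiable one_ne_zero
  have dF : ∀ l, Differentiable ℝ (fun y => F y l) := fun l => (hF l).differentiable one_ne_zero
  have hm : ∀ l k, pgrad (fun y => φ y * F y l) x k =
      φ x * pgrad (fun y => F y l) x k + F x l * pgrad φ x k := fun l k =>
    pgrad_mul dφ (dF l) x k
  have hn : ∀ l k, pgrad (fun y => -(φ y * F y l)) x k = -pgrad (fun y => φ y * F y l) x k := by
    intro l k
    simp [pgrad]
  fin_cases j <;>
    simp [vdiv, Fin.sum_univ_three, vcurl, cross_zero', cross_one', cross_two', hm, hn,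
      pgrad_const] <;> ring

/-- The product of the barycentric coordinates at `v` and `a`. -/
noncomputable def bubble (v a : E3) (T : Finset E3) (x : E3) : ℝ := bary T v x * bary T a x

theorem bubble_isPoly (v a : E3) (T : Finset E3) : IsPoly 2 (bubble v a T) :=
  (bary_isPoly T v).mul (bary_isPoly T a)

section Field

variable {K : Geometry.SimplicialComplex ℝ E3}

/-- The matrix field with rows `bubble • m T i` on the tetrahedra `T` containing the edge `v a`. -/
noncomputable def edgeField (hK : IsTetMesh K) (v a : E3)
    (m : Finset E3 → Fin 3 → E3 → Fin 3 → ℝ) (x : E3) : Mat3 :=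
  Matrix.of fun i l => pw (hK.star v a) (fun T x => bubble v a T x * m T i x l) x

/-- The piecewise curl of `edgeField`. -/
noncomputable def edgeCurl (hK : IsTetMesh K) (v a : E3)
    (m : Finset E3 → Fin 3 → E3 → Fin 3 → ℝ) (x : E3) : Mat3 :=
  Matrix.of fun i j =>
    pw (hK.star v a) (fun T x => vcurl (fun y => bubble v a T y • m T i y) x j) x

/-- The tangential components of the rows of `m` on the facets containing the edge `v a` agree. -/
def TanCompat (hK : IsTetMesh K) (v a : E3) (m : Finset E3 → Fin 3 → E3 → Fin 3 → ℝ) : Prop :=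
  ∀ T ∈ hK.star v a, ∀ T' ∈ hK.star v a, T ≠ T' → ∀ b, v ≠ b → a ≠ b → b ∈ T → b ∈ T' →
    ∀ s ∈ refTri, ∀ i,
      m T i (triPt v a b s) ⬝ᵥ (a - v).ofLp = m T' i (triPt v a b s) ⬝ᵥ (a - v).ofLp ∧
      m T i (triPt v a b s) ⬝ᵥ (b - v).ofLp = m T' i (triPt v a b s) ⬝ᵥ (b - v).ofLp

/-- The Binet–Cauchy identity. The flux of `u × e` through a facet depends only on tangential
components of `u` and `e`; this links `H(curl)` and `H(div)` conformity to tangential continuity. -/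
theorem cross_dot_triNormal (u e : Fin 3 → ℝ) (v a b : E3) :
    (u ⨯₃ e) ⬝ᵥ triNormal v a b =
      (u ⬝ᵥ (a - v).ofLp) * (e ⬝ᵥ (b - v).ofLp) - (u ⬝ᵥ (b - v).ofLp) * (e ⬝ᵥ (a - v).ofLp) := by
  simp only [triNormal, dot3, cross_zero', cross_one', cross_two']
  ring

theorem bubble_eq_of_facet {T : Finset E3} {v a b d : E3} (h : Labeled T v a b d)
    (s : Fin 2 → ℝ) :
    bubble v a T (triPt v a b s) = (1 - s 0 - s 1) * s 0 := by
  have e := bary_triPt T v a b d s 0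
  simp only [zero_smul, add_zero] at e
  rw [bubble, e, e, bary_self h.tet h.mem_v, bary_self h.tet h.mem_a, bary_ne h.tet h.mem_a h.va.symm,
    bary_ne h.tet h.mem_b h.vb.symm, bary_ne h.tet h.mem_b h.ab.symm, bary_ne h.tet h.mem_v h.va]
  ring

variable {hK : IsTetMesh K} {v a : E3} {m : Finset E3 → Fin 3 → E3 → Fin 3 → ℝ} {r : ℕ}

theorem star_subset_cells (hK : IsTetMesh K) (v a : E3) : ∀ T ∈ hK.star v a, T ∈ cells K :=
  fun _ hT => (hK.mem_star.1 hT).1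

theorem bubble_smul_contDiff (hm : ∀ T i l, IsPoly r fun x => m T i x l) (T : Finset E3)
    (i l : Fin 3) : ContDiff ℝ 1 fun x => (bubble v a T x • m T i x) l :=
  ((bubble_isPoly v a T).mul (hm T i l)).contDiff.of_le (by exact_mod_cast le_top)

theorem edgeField_of_mem {T : Finset E3} (hT : T ∈ hK.star v a) {x : E3}
    (hx : x ∈ interior (hull T)) (i : Fin 3) :
    edgeField hK v a m x i = bubble v a T x • m T i x := by
  funext l
  exact pw_of_mem (star_subset_cells hK v a) _ hT hx

theorem edgeField_of_notMem {T : Finset E3} (hTK : T ∈ cells K) (hT : T ∉ hK.star v a) {x : E3}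
    (hx : x ∈ interior (hull T)) : edgeField hK v a m x = 0 := by
  ext i l
  exact pw_of_notMem (star_subset_cells hK v a) _ hTK hT hx

theorem edgeCurl_of_mem {T : Finset E3} (hT : T ∈ hK.star v a) {x : E3}
    (hx : x ∈ interior (hull T)) (i : Fin 3) :
    edgeCurl hK v a m x i = vcurl (fun y => bubble v a T y • m T i y) x := by
  funext l
  exact pw_of_mem (star_subset_cells hK v a) _ hT hx

theorem edgeCurl_of_notMem {T : Finset E3} (hTK : T ∈ cells K) (hT : T ∉ hK.star v a) {x : E3}
    (hx : x ∈ interior (hull T)) : edgeCurl hK v a m x = 0 := by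
  ext i l
  exact pw_of_notMem (star_subset_cells hK v a) _ hTK hT hx

/-- The defect in the weak identity is a sum of cellwise integrals of `div (φ F × eⱼ)`. The bubble
removes the facets without the edge, `TanCompat` cancels the shared facets, and `φ` vanishes on the
unshared ones. -/
theorem hasWeakCurl_edgeField (hva : v ≠ a) (hm : ∀ T i l, IsPoly r fun x => m T i x l)
    (hc : TanCompat hK v a m) :
    HasWeakCurl (domain K) (edgeField hK v a m) (edgeCurl hK v a m) := by
  have hF := fun T i l => bubble_smul_contDiff (v := v) (a := a) hm T i l
  refine ⟨fun i j => memLp_pw _ (fun T => continuous_vcurl (hF T i) j) _, ?_⟩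
  rintro φ ⟨hφ, -, hsupp⟩ i j
  have hφ1 : ContDiff ℝ 1 φ := hφ.of_le (by exact_mod_cast le_top)
  have hφc : ∀ l, Continuous fun x => pgrad φ x l := continuous_pgrad hφ1
  have hcross : ∀ T, Continuous fun x => (pgrad φ x ⨯₃ (bubble v a T x • m T i x)) j := fun T =>
    continuous_cross hφc (fun l => (hF T i l).continuous) j
  have hcurl : ∀ T, Continuous fun x => vcurl (fun y => bubble v a T y • m T i y) x j * φ x :=
    fun T => (continuous_vcurl (hF T i) j).mul hφ.continuous
  rw [hK.integral_star (v := v) (a := a) hcurl (fun T hT x hx => by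
      rw [edgeCurl_of_mem hT hx]) (fun T hTK hT x hx => by
      rw [edgeCurl_of_notMem hTK hT hx]; simp),
    hK.integral_star (v := v) (a := a) hcross (fun T hT x hx => by
      rw [edgeField_of_mem hT hx]) (fun T hTK hT x hx => by
      rw [edgeField_of_notMem hTK hT hx]; simp [cross_apply]; fin_cases j <;> simp),
    ← sub_eq_zero, sub_neg_eq_add, ← Finset.sum_add_distrib]
  have key := hK.sum_star_integral_vdiv_eq_zero hva
    (Z := fun T y => (φ y • bubble v a T y • m T i y) ⨯₃ Pi.single j 1) ?_ ?_ ?_ ?_ ?_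
  · rw [← key]
    refine Finset.sum_congr rfl fun T hT => ?_
    rw [← integral_add (integrableOn_interior_hull T (hcurl T))
      (integrableOn_interior_hull T (hcross T))]
    exact integral_congr_ae (Eventually.of_forall fun x => (vdiv_smul_cross hφ1 (hF T i) j x).symm)
  · intro T l
    have h : ∀ l, ContDiff ℝ 1 fun x => (φ x • bubble v a T x • m T i x) l := fun l =>
      hφ1.mul (hF T i l)
    exact contDiff_cross (G := fun _ => Pi.single j 1) h (fun _ => contDiff_const) l
  · intro T hT x hx
    simp [bubble, hx]
  · intro T hT x hx
    simp [bubble, hx]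
  · intro T hT T' hT' hne b hvb hab hbT hbT' s hs
    obtain ⟨h1, h2⟩ := hc T hT T' hT' hne b hvb hab hbT hbT' s hs i
    obtain ⟨hTK, hvT, haT⟩ := hK.mem_star.1 hT
    obtain ⟨hTK', hvT', haT'⟩ := hK.mem_star.1 hT'
    obtain ⟨d, hd⟩ := (isTet_of_mem_cells hTK).exists_labeled_of_three hvT haT hbT hva hvb hab
    obtain ⟨d', hd'⟩ := (isTet_of_mem_cells hTK').exists_labeled_of_three hvT' haT' hbT' hva hvb hab
    simp only [cross_dot_triNormal, smul_dotProduct, h1, h2, bubble_eq_of_facet hd,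
      bubble_eq_of_facet hd']
  · intro T hT x hx
    have : φ x = 0 := image_eq_zero_of_notMem_tsupport fun h => hx (hsupp h)
    simp [this]

theorem edgeField_mem_Mring (hva : v ≠ a) (hm : ∀ T i l, IsPoly r fun x => m T i x l)
    (hc : TanCompat hK v a m) : edgeField hK v a m ∈ Mring K r v := by
  -- The bubble has degree two, so `m` of degree `r` uses up the full degree of `M_h`.
  have hp : ∀ T i l, IsPoly (r + 2) fun x => bubble v a T x * m T i x l := fun T i l =>
    ((bubble_isPoly v a T).mul (hm T i l)).mono (by omega)
  have hcont : ∀ T i l, Continuous fun x => bubble v a T x * m T i x l := fun T i l =>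
    (hp T i l).contDiff.continuous
  refine ⟨⟨?_, fun i l => memLp_pw _ (fun T => hcont T i l) _, _, hasWeakCurl_edgeField hva hm hc⟩,
    ?_, ?_⟩
  · intro T hTK i l
    by_cases hT : T ∈ hK.star v a
    · obtain ⟨p, hp1, hp2⟩ := hp T i l
      exact ⟨p, hp1, fun x hx => by rw [edgeField_of_mem hT hx, ← hp2]; rfl⟩
    · exact ⟨0, by simp, fun x hx => by rw [edgeField_of_notMem hTK hT hx]; simp⟩
  · rintro x ⟨-, hx⟩
    ext i l
    refine Finset.sum_eq_zero fun T hT => Set.indicator_of_notMem (fun hx' => hx ?_) _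
    obtain ⟨hTK, hvT, -⟩ := hK.mem_star.1 hT
    exact Set.mem_biUnion (show T ∈ patchCells K v from ⟨hTK, hvT⟩) (interior_subset hx')
  · rintro T ⟨hTK, hvT⟩ f hf - hvf n - x hx
    by_cases hT : T ∈ hK.star v a
    -- On an outer facet the factor `λ_v` kills the whole trace of the field, not just `(Ξ μ) n`.
    · have hx0 : bary T v x = 0 := by
        have h2 : Convex ℝ {x | bary T v x = 0} :=
          (convex_singleton (0 : ℝ)).affine_preimage (bary T v)
        refine convexHull_min (fun y hy => ?_) h2 hx
        exact bary_ne (isTet_of_mem_cells hTK) (hf hy) fun h => hvf (h ▸ hy)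
      have h3 : Continuous fun y => Xi (Matrix.of fun i l => bubble v a T y * m T i y l) *ᵥ n := by
        have : Continuous fun y => (Matrix.of fun i l => bubble v a T y * m T i y l : Mat3) :=
          continuous_pi fun i => continuous_pi fun l => hcont T i l
        unfold Xi
        exact (this.matrix_transpose.sub (this.matrix_trace.smul continuous_const)).matrix_mulVec
          continuous_const
      have h4 := h3.tendsto x
      have h5 : (Matrix.of fun i l => bubble v a T x * m T i x l : Mat3) = 0 := by
        ext i l
        simp [bubble, hx0]
      rw [h5] at h4
      have h6 : Xi 0 *ᵥ n = 0 := by simp [Xi]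
      rw [h6] at h4
      refine (h4.mono_left nhdsWithin_le_nhds).congr' ?_
      filter_upwards [self_mem_nhdsWithin] with y hy
      congr 2
      ext i l
      rw [edgeField_of_mem hT hy]
      rfl
    · refine tendsto_const_nhds.congr' ?_
      filter_upwards [self_mem_nhdsWithin] with y hy
      rw [edgeField_of_notMem hTK hT hy]
      simp [Xi]

end Field

/-! ### Axial vectors and tangential continuity -/

/-- The skew-symmetric matrix with axial vector `w`. Its rows are `eᵢ × w`. -/
noncomputable def axl (w : Fin 3 → ℝ) : Mat3 := Matrix.of fun i => Pi.single i 1 ⨯₃ w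

theorem axl_row (w : Fin 3 → ℝ) (i : Fin 3) : axl w i = Pi.single i 1 ⨯₃ w := rfl

theorem eq_axl_of_transpose_eq_neg {A : Mat3} (h : Aᵀ = -A) : A = axl ![A 2 1, A 0 2, A 1 0] := by
  have e : ∀ i j, A j i = - A i j := fun i j => congrFun (congrFun h i) j
  have e00 := e 0 0
  have e11 := e 1 1
  have e22 := e 2 2
  ext i j
  fin_cases i <;> fin_cases j <;> simp [axl, cross_apply] <;>
    first | linarith | linarith [e 0 1] | linarith [e 0 2] | linarith [e 1 2]

theorem frob_skw_axl (A : Mat3) (w : Fin 3 → ℝ) : frob (skw A) (axl w) =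
    (A 2 1 - A 1 2) * w 0 + (A 0 2 - A 2 0) * w 1 + (A 1 0 - A 0 1) * w 2 := by
  simp [frob, skw, axl, cross_apply, Fin.sum_univ_three]
  ring

theorem vdiv_smul {φ : E3 → ℝ} {F : E3 → Fin 3 → ℝ} (hφ : ContDiff ℝ 1 φ)
    (hF : ∀ l, ContDiff ℝ 1 fun x => F x l) (x : E3) :
    vdiv (fun y => φ y • F y) x = vdiv F x * φ x + F x ⬝ᵥ pgrad φ x := by
  have dφ := hφ.differentiable one_ne_zero
  have dF : ∀ l, Differentiable ℝ (fun y => F y l) := fun l => (hF l).differentiable one_ne_zero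
  have hm : ∀ l k, pgrad (fun y => φ y * F y l) x k =
      φ x * pgrad (fun y => F y l) x k + F x l * pgrad φ x k := fun l k =>
    pgrad_mul dφ (dF l) x k
  simp only [vdiv, Fin.sum_univ_three, Pi.smul_apply, smul_eq_mul, hm, dot3]
  ring

theorem continuous_vdiv {F : E3 → Fin 3 → ℝ} (hF : ∀ l, ContDiff ℝ 1 fun x => F x l) :
    Continuous (vdiv F) :=
  continuous_finsetSum _ fun l _ => continuous_pgrad (hF l) l

theorem vdiv_eq_zero_of_eventuallyEq {F : E3 → Fin 3 → ℝ} {x : E3}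
    (h : ∀ᶠ y in 𝓝 x, F y = 0) : vdiv F x = 0 := by
  refine Finset.sum_eq_zero fun l _ => ?_
  have : (fun y => F y l) =ᶠ[𝓝 x] fun _ => 0 := h.mono fun y hy => by simp [hy]
  simp [pgrad, this.fderiv_eq]

/-! ### The weak divergence of a skew-symmetric field, cell by cell. -/

section Div

variable {K : Geometry.SimplicialComplex ℝ E3} {r : ℕ} {q : E3 → Mat3}

/-- `W` describes the axial vectors of `q` on the tetrahedra of the mesh. -/
structure IsAxial (K : Geometry.SimplicialComplex ℝ E3) (r : ℕ) (q : E3 → Mat3)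
    (W : Finset E3 → E3 → Fin 3 → ℝ) : Prop where
  poly : ∀ T l, IsPoly (r + 1) fun x => W T x l
  eq : ∀ T ∈ cells K, ∀ x ∈ interior (hull T), q x = axl (W T x)

theorem exists_isAxial (hq : q ∈ Qt K r) : ∃ W, IsAxial K r q W := by
  classical
  obtain ⟨hp, hs, -⟩ := hq
  choose! p hp1 hp2 using hp
  -- The value zero off the mesh makes the polynomial and smoothness statements hold for every `T`,
  -- without a side condition.
  refine ⟨fun T x => if T ∈ cells K then ![MvPolynomial.eval (fun l => x l) (p T 2 1),
    MvPolynomial.eval (fun l => x l) (p T 0 2), MvPolynomial.eval (fun l => x l) (p T 1 0)] else 0,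
    fun T l => ?_, fun T hT x hx => ?_⟩
  · by_cases hT : T ∈ cells K
    · simp only [hT, if_true]
      fin_cases l
      · exact ⟨_, hp1 T hT 2 1, fun x => rfl⟩
      · exact ⟨_, hp1 T hT 0 2, fun x => rfl⟩
      · exact ⟨_, hp1 T hT 1 0, fun x => rfl⟩
    · simp only [hT, if_false]
      exact IsPoly.const _ 0
  · simp only [hT, if_true]
    rw [← hp2 T hT 2 1 x hx, ← hp2 T hT 0 2 x hx, ← hp2 T hT 1 0 x hx]
    exact eq_axl_of_transpose_eq_neg (hs T hT x hx)

variable {W : Finset E3 → E3 → Fin 3 → ℝ}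

theorem IsAxial.contDiff (hW : IsAxial K r q W) (T : Finset E3) (l : Fin 3) :
    ContDiff ℝ 1 fun x => W T x l :=
  (hW.poly T l).contDiff.of_le (by exact_mod_cast le_top)

theorem IsAxial.contDiff_row (hW : IsAxial K r q W) (T : Finset E3) (i l : Fin 3) :
    ContDiff ℝ 1 fun x => axl (W T x) i l :=
  contDiff_cross (F := fun _ => Pi.single i 1) (fun _ => contDiff_const) (hW.contDiff T) l

theorem integral_interior_hull_vdiv_of_tsupport {T : Finset E3} (hT : IsTet T)
    {φ : E3 → ℝ} (hφ : ContDiff ℝ 1 φ) (hsupp : tsupport φ ⊆ interior (hull T))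
    {F : E3 → Fin 3 → ℝ} (hF : ∀ l, ContDiff ℝ 1 fun x => F x l) :
    ∫ x in interior (hull T), vdiv (fun y => φ y • F y) x = 0 := by
  have h0 : ∀ p ∈ T, ∀ x, bary T p x = 0 → φ x = 0 := by
    intro p hp x hx
    refine image_eq_zero_of_notMem_tsupport fun h => ?_
    exact ((mem_interior_hull_iff hT).1 (hsupp h) p hp).ne' hx
  obtain ⟨v, hv⟩ : T.Nonempty := by rw [← Finset.card_pos, hT.card]; norm_num
  obtain ⟨a, b, d, h⟩ := hT.exists_labeled_of_one hv
  rw [integral_tet_vdiv (F := fun y => φ y • F y) h (fun l => hφ.mul (hF l))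
    (fun x hx => by simp [h0 v h.mem_v x hx]) (fun x hx => by simp [h0 a h.mem_a x hx])]
  have e1 : triInt v a b (fun x => (φ x • F x) ⬝ᵥ triNormal v a b) = triInt v a b fun _ => 0 :=
    triInt_congr fun s _ => by simp [h0 d h.mem_d _ (bary_triPt_facet h s)]
  have e2 : triInt v a d (fun x => (φ x • F x) ⬝ᵥ triNormal v a d) = triInt v a d fun _ => 0 :=
    triInt_congr fun s _ => by simp [h0 b h.mem_b _ (bary_triPt_facet h.swap s)]
  rw [e1, e2]
  simp [triInt]

/-- Testing with functions supported inside one cell identifies the weak divergence with the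
classical one, by the fundamental lemma of the calculus of variations. -/
theorem IsAxial.weakDiv_ae_eq (hW : IsAxial K r q W) {δ : E3 → Fin 3 → ℝ}
    (hδ : HasWeakDiv (domain K) q δ) {T : Finset E3} (hT : T ∈ cells K) (i : Fin 3) :
    ∀ᵐ x, x ∈ interior (hull T) → δ x i = vdiv (fun y => axl (W T y) i) x := by
  have hsub := interior_hull_subset_domain hT
  have hF := hW.contDiff_row T i
  have hlt : volume (interior (hull T)) < ⊤ :=
    (measure_mono interior_subset).trans_lt (isCompact_hull T).measure_lt_top
  have : IsFiniteMeasure (volume.restrict (interior (hull T))) := ⟨by simpa using hlt⟩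
  have hint1 : IntegrableOn (fun x => δ x i) (interior (hull T)) :=
    ((hδ.1 i).mono_measure (Measure.restrict_mono hsub le_rfl)).integrable (by norm_num)
  have hint2 : IntegrableOn (vdiv fun y => axl (W T y) i) (interior (hull T)) :=
    integrableOn_interior_hull T (continuous_vdiv hF)
  have key := isOpen_interior.ae_eq_zero_of_integral_contDiff_smul_eq_zero
    (μ := volume) (U := interior (hull T))
    (f := fun x => δ x i - vdiv (fun y => axl (W T y) i) x)
    (hint1.sub hint2).locallyIntegrableOn ?_
  · filter_upwards [key] with x hx hxT
    exact sub_eq_zero.1 (hx hxT)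
  · intro φ hφ hcs hsupp
    have hφ1 : ContDiff ℝ 1 φ := hφ.of_le (by exact_mod_cast le_top)
    have h0 : ∀ x, x ∉ interior (hull T) → φ x = 0 := fun x hx =>
      image_eq_zero_of_notMem_tsupport fun h => hx (hsupp h)
    have h0' : ∀ x, x ∉ interior (hull T) → pgrad φ x = 0 := fun x hx => by
      have : fderiv ℝ φ x = 0 := by
        by_contra h
        exact hx (hsupp (support_fderiv_subset ℝ h))
      funext l
      simp [pgrad, this]
    have e1 := hδ.2 φ ⟨hφ, hcs, hsupp.trans hsub⟩ i
    have hΩ : MeasurableSet (domain K) := isOpen_interior.measurableSet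
    have e5 : ∫ x in domain K, δ x i * φ x = ∫ x in interior (hull T), δ x i * φ x :=
      setIntegral_eq_of_subset_of_forall_sdiff_eq_zero hΩ hsub
        fun x hx => by rw [h0 x hx.2, mul_zero]
    have e6 : ∫ x in domain K, q x i ⬝ᵥ pgrad φ x = ∫ x in interior (hull T), q x i ⬝ᵥ pgrad φ x :=
      setIntegral_eq_of_subset_of_forall_sdiff_eq_zero hΩ hsub
        fun x hx => by rw [h0' x hx.2, dotProduct_zero]
    rw [e5, e6] at e1
    have e2 := integral_interior_hull_vdiv_of_tsupport (isTet_of_mem_cells hT) hφ1 hsupp hF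
    have hc1 : Continuous fun x => vdiv (fun y => axl (W T y) i) x * φ x :=
      (continuous_vdiv hF).mul hφ.continuous
    have hc2 : Continuous fun x => axl (W T x) i ⬝ᵥ pgrad φ x := by
      simp only [dot3]
      exact (((hF 0).continuous.mul (continuous_pgrad hφ1 0)).add
        ((hF 1).continuous.mul (continuous_pgrad hφ1 1))).add
        ((hF 2).continuous.mul (continuous_pgrad hφ1 2))
    simp only [vdiv_smul hφ1 hF] at e2
    rw [integral_add (integrableOn_interior_hull T hc1) (integrableOn_interior_hull T hc2)] at e2
    have e3 : ∫ x in interior (hull T), q x i ⬝ᵥ pgrad φ x =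
        ∫ x in interior (hull T), axl (W T x) i ⬝ᵥ pgrad φ x :=
      setIntegral_congr_fun isOpen_interior.measurableSet fun x hx => by
        simp only [hW.eq T hT x hx]
    have e4 : ∫ x, φ x • (δ x i - vdiv (fun y => axl (W T y) i) x) =
        ∫ x in interior (hull T), (δ x i * φ x - vdiv (fun y => axl (W T y) i) x * φ x) := by
      rw [← setIntegral_eq_integral_of_forall_compl_eq_zero (s := interior (hull T))
        (fun x hx => by rw [h0 x hx, zero_smul])]
      refine integral_congr_ae (Eventually.of_forall fun x => ?_)
      simp only [smul_eq_mul]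
      ring
    have hint3 : IntegrableOn (fun x => δ x i * φ x) (interior (hull T)) := by
      obtain ⟨C, hC⟩ := hcs.exists_bound_of_continuous hφ.continuous
      exact hint1.mul_bdd hφ.continuous.aestronglyMeasurable (Eventually.of_forall hC)
    rw [e4, integral_sub hint3 (integrableOn_interior_hull T hc1), e1, e3]
    linarith

end Div

/-! ### Tangential continuity of the axial vector across interior facets. -/

section Tangential

variable {K : Geometry.SimplicialComplex ℝ E3} {r : ℕ} {q : E3 → Mat3}
  {W : Finset E3 → E3 → Fin 3 → ℝ}

/-- Replacing the weak divergence by the cellwise one turns membership in `H(div)` into a statement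
about facet fluxes alone. -/
theorem IsAxial.sum_integral_vdiv (hK : IsTetMesh K) (hW : IsAxial K r q W)
    (hq : MemHdiv (domain K) q) {φ : E3 → ℝ} (hφ : IsTest (domain K) φ) (i : Fin 3) :
    ∑ T ∈ hK.cellFinset, ∫ x in interior (hull T), vdiv (fun y => φ y • axl (W T y) i) x = 0 := by
  obtain ⟨-, δ, hδ⟩ := hq
  have hφ1 : ContDiff ℝ 1 φ := hφ.1.of_le (by exact_mod_cast le_top)
  have hF := fun T => hW.contDiff_row T i
  have hc1 : ∀ T, Continuous fun x => vdiv (fun y => axl (W T y) i) x * φ x := fun T =>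
    (continuous_vdiv (hF T)).mul hφ1.continuous
  have hc2 : ∀ T, Continuous fun x => axl (W T x) i ⬝ᵥ pgrad φ x := by
    intro T
    simp only [dot3]
    exact (((hF T 0).continuous.mul (continuous_pgrad hφ1 0)).add
      ((hF T 1).continuous.mul (continuous_pgrad hφ1 1))).add
      ((hF T 2).continuous.mul (continuous_pgrad hφ1 2))
  have ae1 : ∀ T ∈ cells K, (fun x => δ x i * φ x) =ᵐ[volume.restrict (interior (hull T))]
      fun x => vdiv (fun y => axl (W T y) i) x * φ x := by
    intro T hT
    refine (ae_restrict_iff' isOpen_interior.measurableSet).2 ?_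
    filter_upwards [hW.weakDiv_ae_eq hδ hT i] with x hx hxT
    rw [hx hxT]
  have ae2 : ∀ T ∈ cells K, Set.EqOn (fun x => q x i ⬝ᵥ pgrad φ x)
      (fun x => axl (W T x) i ⬝ᵥ pgrad φ x) (interior (hull T)) := by
    intro T hT x hx
    simp only [hW.eq T hT x hx]
  have e := hδ.2 φ hφ i
  rw [hK.integral_domain fun T hT => (integrableOn_interior_hull T (hc1 T)).congr_fun_ae
      (ae1 T hT).symm,
    hK.integral_domain fun T hT => (integrableOn_interior_hull T (hc2 T)).congr_fun
      (ae2 T hT).symm isOpen_interior.measurableSet, ← sub_eq_zero, sub_neg_eq_add,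
    ← Finset.sum_add_distrib] at e
  rw [← e]
  refine Finset.sum_congr rfl fun T hT => ?_
  have hT := hK.mem_cellFinset.1 hT
  simp only [vdiv_smul hφ1 (hF T)]
  rw [integral_add (integrableOn_interior_hull T (hc1 T)) (integrableOn_interior_hull T (hc2 T)),
    integral_congr_ae (ae1 T hT), setIntegral_congr_fun isOpen_interior.measurableSet (ae2 T hT)]

/-- The zero sets of the two coordinates are the same plane, and `d`, `d'` lie on opposite sides of
it. -/
theorem bary_nonneg_or_bary_nonneg {T T' : Finset E3} (hT : T ∈ cells K) (hT' : T' ∈ cells K)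
    (hne : T ≠ T') {v a b d d' : E3} (h : Labeled T v a b d) (h' : Labeled T' v a b d') (x : E3) :
    0 ≤ bary T d x ∨ 0 ≤ bary T' d' x := by
  have e1 := bary_mul_vol6 h x
  have e2 := bary_mul_vol6 h' x
  have h3 := vol6_mul_neg hT hT' hne h h'
  by_contra! h5
  have h4 : bary T d x * bary T' d' x * (vol6 v a b d * vol6 v a b d') =
      (triNormal v a b ⬝ᵥ (x - v).ofLp) ^ 2 := by
    calc _ = bary T d x * vol6 v a b d * (bary T' d' x * vol6 v a b d') := by ring
      _ = _ := by rw [e1, e2, sq]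
  have := mul_neg_of_pos_of_neg (mul_pos_of_neg_of_neg h5.1 h5.2) h3
  rw [h4] at this
  exact absurd this (not_lt.2 (sq_nonneg _))

theorem mem_hull_or_mem_hull {T T' : Finset E3} (hT : T ∈ cells K) (hT' : T' ∈ cells K)
    (hne : T ≠ T') {v a b d d' : E3} (h : Labeled T v a b d) (h' : Labeled T' v a b d') {x : E3}
    (hx : ∀ p, p = v ∨ p = a ∨ p = b → 0 ≤ bary T p x)
    (hx' : ∀ p, p = v ∨ p = a ∨ p = b → 0 ≤ bary T' p x) : x ∈ hull T ∨ x ∈ hull T' := by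
  refine (bary_nonneg_or_bary_nonneg hT hT' hne h h' x).imp (fun h5 => ?_) fun h5 => ?_
  · rw [mem_hull_iff h.tet, h.forall_iff]
    exact ⟨hx _ (by simp), hx _ (by simp), hx _ (by simp), h5⟩
  · rw [mem_hull_iff h'.tet, h'.forall_iff]
    exact ⟨hx' _ (by simp), hx' _ (by simp), hx' _ (by simp), h5⟩

theorem orient_ne_zero {T : Finset E3} {v a b d : E3} (h : Labeled T v a b d) :
    orient v a b T ≠ 0 := by
  rw [orient_eq h, Ne, Real.sign_eq_zero_iff]
  exact vol6_ne_zero h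

/-- The open neighbourhood of the relative interior of the facet `v a b` on which all barycentric
coordinates at `v`, `a` and `b` are positive. -/
def facetNhd (v a b : E3) (T T' : Finset E3) : Set E3 :=
  {x | ∀ p ∈ ({v, a, b} : Finset E3), 0 < bary T p x ∧ 0 < bary T' p x}

theorem isOpen_facetNhd (v a b : E3) (T T' : Finset E3) : IsOpen (facetNhd v a b T T') := by
  have : facetNhd v a b T T' = ⋂ p ∈ ({v, a, b} : Finset E3),
      {x | 0 < bary T p x ∧ 0 < bary T' p x} := by
    ext x; simp [facetNhd]
  rw [this]
  exact isOpen_biInter_finset fun p _ => (isOpen_lt continuous_const (bary_continuous T p)).inter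
    (isOpen_lt continuous_const (bary_continuous T' p))

theorem facetNhd_subset_hull {T T' : Finset E3} (hT : T ∈ cells K) (hT' : T' ∈ cells K)
    (hne : T ≠ T') {v a b d d' : E3} (h : Labeled T v a b d) (h' : Labeled T' v a b d') :
    facetNhd v a b T T' ⊆ hull T ∪ hull T' := fun x hx =>
  mem_hull_or_mem_hull hT hT' hne h h' (fun p hp => (hx p (by simpa using hp)).1.le)
    fun p hp => (hx p (by simpa using hp)).2.le

/-- The support of `φ` meets only `T` and `T'`, and on each of them only the facet `v a b`. The
opposite orientations turn the sum of the two fluxes into a jump. -/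
theorem triInt_jump_eq_zero (hK : IsTetMesh K) (hW : IsAxial K r q W)
    (hq : MemHdiv (domain K) q) {T T' : Finset E3} (hT : T ∈ cells K) (hT' : T' ∈ cells K)
    (hne : T ≠ T') {v a b d d' : E3} (h : Labeled T v a b d) (h' : Labeled T' v a b d')
    {φ : E3 → ℝ} (hφ : ContDiff ℝ ∞ φ) (hcs : HasCompactSupport φ)
    (hsupp : tsupport φ ⊆ facetNhd v a b T T') (i : Fin 3) :
    triInt v a b (fun x => φ x * ((axl (W T x) i - axl (W T' x) i) ⬝ᵥ triNormal v a b)) = 0 := by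
  have hφ1 : ContDiff ℝ 1 φ := hφ.of_le (by exact_mod_cast le_top)
  have hsub := facetNhd_subset_hull hT hT' hne h h'
  have hspace : facetNhd v a b T T' ⊆ domain K := by
    refine interior_maximal (fun x hx => ?_) (isOpen_facetNhd v a b T T')
    rcases hsub hx with hx | hx
    · exact hK.mem_space_iff.2 ⟨T, hT, hx⟩
    · exact hK.mem_space_iff.2 ⟨T', hT', hx⟩
  have h0 : ∀ x, x ∉ facetNhd v a b T T' → φ x = 0 := fun x hx =>
    image_eq_zero_of_notMem_tsupport fun hx' => hx (hsupp hx')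
  have hb : ∀ p ∈ ({v, a, b} : Finset E3), ∀ x, bary T p x = 0 ∨ bary T' p x = 0 → φ x = 0 := by
    intro p hp x hx
    refine h0 x fun hx' => ?_
    rcases hx with hx | hx
    · exact (hx' p hp).1.ne' hx
    · exact (hx' p hp).2.ne' hx
  have hF := fun T => hW.contDiff_row T i
  have key := hW.sum_integral_vdiv hK hq ⟨hφ, hcs, hsupp.trans hspace⟩ i
  rw [Finset.sum_eq_add_of_mem T T' (hK.mem_cellFinset.2 hT) (hK.mem_cellFinset.2 hT') hne] at key
  · rw [integral_tet_vdiv (F := fun y => φ y • axl (W T y) i) h (fun l => hφ1.mul (hF T l))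
        (fun x hx => by simp [hb v (by simp) x (Or.inl hx)])
        (fun x hx => by simp [hb a (by simp) x (Or.inl hx)]),
      integral_tet_vdiv (F := fun y => φ y • axl (W T' y) i) h' (fun l => hφ1.mul (hF T' l))
        (fun x hx => by simp [hb v (by simp) x (Or.inr hx)])
        (fun x hx => by simp [hb a (by simp) x (Or.inr hx)])] at key
    have e1 : triInt v a d (fun x => (φ x • axl (W T x) i) ⬝ᵥ triNormal v a d) = 0 :=
      (triInt_congr (g := fun _ => 0) fun s _ => by
        simp [hb b (by simp) _ (Or.inl (bary_triPt_facet h.swap s))]).trans (by simp [triInt])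
    have e2 : triInt v a d' (fun x => (φ x • axl (W T' x) i) ⬝ᵥ triNormal v a d') = 0 :=
      (triInt_congr (g := fun _ => 0) fun s _ => by
        simp [hb b (by simp) _ (Or.inr (bary_triPt_facet h'.swap s))]).trans (by simp [triInt])
    rw [e1, e2, orient_add_orient hT hT' hne h h'] at key
    have hc : ∀ T, Continuous fun x => (φ x • axl (W T x) i) ⬝ᵥ triNormal v a b := fun T =>
      (contDiff_dot_const (fun l => hφ1.mul (hF T l)) _).continuous
    have e3 : triInt v a b
        (fun x => φ x * ((axl (W T x) i - axl (W T' x) i) ⬝ᵥ triNormal v a b)) =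
        triInt v a b (fun x => (φ x • axl (W T x) i) ⬝ᵥ triNormal v a b) +
        (-1) * triInt v a b (fun x => (φ x • axl (W T' x) i) ⬝ᵥ triNormal v a b) := by
      rw [← triInt_const_mul, ← triInt_add (g := fun x => -1 * ((φ x • axl (W T' x) i) ⬝ᵥ
        triNormal v a b)) _ _ _ (hc T) (continuous_const.mul (hc T'))]
      congr 1
      funext x
      simp only [sub_dotProduct, smul_dotProduct, smul_eq_mul]
      ring
    rw [e3]
    refine (mul_eq_zero.1 (?_ : orient v a b T * _ = 0)).resolve_left (orient_ne_zero h)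
    linarith
  -- On any other cell `φ` is identically zero, since `facetNhd` lies in `hull T ∪ hull T'`.
  · rintro S hS ⟨h1, h2⟩
    have hS := hK.mem_cellFinset.1 hS
    refine (setIntegral_congr_fun isOpen_interior.measurableSet fun x hx => ?_).trans
      (integral_zero _ _)
    refine vdiv_eq_zero_of_eventuallyEq ?_
    filter_upwards [isOpen_interior.mem_nhds hx] with y hy
    rw [h0 y, zero_smul]
    intro hy'
    rcases hsub hy' with hy' | hy'
    · exact h1 (cell_eq_of_mem_interior hT hS hy' hy)
    · exact h2 (cell_eq_of_mem_interior hT' hS hy' hy)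

/-- The fundamental lemma on a triangle, tested with functions of the ambient space. Multiplying by
`c`, the value of `P` at the point, makes the integrand nonnegative for a bump function supported
where `P` has the sign of `c`. -/
theorem eq_zero_of_forall_triInt_eq_zero {v a b : E3} {O : Set E3} (hO : IsOpen O) {P : E3 → ℝ}
    (hP : Continuous P) (hint : ∀ φ : E3 → ℝ, ContDiff ℝ ∞ φ → HasCompactSupport φ →
      tsupport φ ⊆ O → triInt v a b (fun x => φ x * P x) = 0) {s : Fin 2 → ℝ} (hs : s ∈ refTri)
    (hsO : triPt v a b s ∈ O) : P (triPt v a b s) = 0 := by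
  by_contra hne
  set c := P (triPt v a b s) with hc
  have hpos : 0 < c * c := mul_self_pos.2 hne
  have hopen : IsOpen (O ∩ {x | 0 < P x * c}) :=
    hO.inter (isOpen_lt continuous_const (hP.mul continuous_const))
  obtain ⟨φ, h1, h2, h3, h4, h5⟩ := exists_contDiff_tsupport_subset (n := ⊤)
    (hopen.mem_nhds (⟨hsO, hpos⟩ : triPt v a b s ∈ O ∩ {x | 0 < P x * c}))
  have h6 := hint φ h3 h2 (h1.trans Set.inter_subset_left)
  have h7 : ∫ t in refTri, φ (triPt v a b t) * P (triPt v a b t) * c = 0 := by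
    rw [integral_mul_const]
    exact mul_eq_zero_of_left h6 c
  have hcont : Continuous fun t => φ (triPt v a b t) * P (triPt v a b t) * c :=
    ((h3.continuous.comp (triPt_continuous v a b)).mul
      (hP.comp (triPt_continuous v a b))).mul continuous_const
  have hnn : ∀ t, 0 ≤ φ (triPt v a b t) * P (triPt v a b t) * c := by
    intro t
    by_cases ht : triPt v a b t ∈ tsupport φ
    · have e1 : 0 < P (triPt v a b t) * c := (h1 ht).2
      have e2 : 0 ≤ φ (triPt v a b t) := (h4 ⟨_, rfl⟩).1
      rw [mul_assoc]
      exact mul_nonneg e2 e1.le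
    · rw [image_eq_zero_of_notMem_tsupport ht]; simp
  rw [setIntegral_eq_zero_iff_of_nonneg_ae (Eventually.of_forall hnn)
    (integrableOn_refTri hcont)] at h7
  have h8 := Measure.eqOn_open_of_ae_eq h7 isOpen_refTri hcont.continuousOn continuousOn_const hs
  simp only [h5, one_mul] at h8
  exact hpos.ne' h8

theorem eq_zero_of_cross_eq_zero {x y : Fin 3 → ℝ} {α β : ℝ} (hN : x ⨯₃ y ≠ 0)
    (h : ∀ i, α * y i = β * x i) : α = 0 ∧ β = 0 := by
  obtain ⟨j, hj⟩ := Function.ne_iff.1 hN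
  rw [cross_cyclic] at hj
  constructor
  · refine (mul_eq_zero.1 (?_ : α * _ = 0)).resolve_right hj
    linear_combination x (j + 1) * h (j + 2) - x (j + 2) * h (j + 1)
  · refine (mul_eq_zero.1 (?_ : β * _ = 0)).resolve_right hj
    linear_combination y (j + 1) * h (j + 2) - y (j + 2) * h (j + 1)

theorem triNormal_ne_zero {T : Finset E3} {v a b d : E3} (h : Labeled T v a b d) :
    triNormal v a b ≠ 0 := by
  intro h0
  refine vol6_ne_zero h ?_
  rw [vol6, h0, zero_dotProduct]

/-- The axial vector of a skew-symmetric `H(div)` field is tangentially continuous. -/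
theorem IsAxial.tangential_eq (hK : IsTetMesh K) (hW : IsAxial K r q W)
    (hq : MemHdiv (domain K) q) {T T' : Finset E3} (hT : T ∈ cells K) (hT' : T' ∈ cells K)
    (hne : T ≠ T') {v a b d d' : E3} (h : Labeled T v a b d) (h' : Labeled T' v a b d')
    {s : Fin 2 → ℝ} (hs : s ∈ refTri) :
    (W T (triPt v a b s) - W T' (triPt v a b s)) ⬝ᵥ (a - v).ofLp = 0 ∧
    (W T (triPt v a b s) - W T' (triPt v a b s)) ⬝ᵥ (b - v).ofLp = 0 := by
  -- Zero normal jump of row `i` reads `(J · (b - v)) (a - v)ᵢ = (J · (a - v)) (b - v)ᵢ`;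
  -- independence of the two edges then makes both coefficients zero.
  refine eq_zero_of_cross_eq_zero (triNormal_ne_zero h) fun i => ?_
  have hc : Continuous fun x => (axl (W T x) i - axl (W T' x) i) ⬝ᵥ triNormal v a b :=
    (contDiff_dot_const (F := fun x => axl (W T x) i - axl (W T' x) i)
      (fun l => (hW.contDiff_row T i l).sub (hW.contDiff_row T' i l)) _).continuous
  have hmem : triPt v a b s ∈ facetNhd v a b T T' := fun p hp => by
    have hp' : p = v ∨ p = a ∨ p = b := by simpa using hp
    exact ⟨bary_triPt_pos h hs hp', bary_triPt_pos h' hs hp'⟩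
  have := eq_zero_of_forall_triInt_eq_zero (isOpen_facetNhd v a b T T') hc
    (fun φ h1 h2 h3 => triInt_jump_eq_zero hK hW hq hT hT' hne h h' h1 h2 h3 i) hs hmem
  rw [axl_row, axl_row, ← map_sub, cross_dot_triNormal] at this
  simp only [single_one_dotProduct] at this
  linarith

end Tangential

/-! ### Vanishing of the gradient on the patch -/

section Gradient

variable {K : Geometry.SimplicialComplex ℝ E3} {r : ℕ} {q : E3 → Mat3}
  {W : Finset E3 → E3 → Fin 3 → ℝ}

/-- The pairing of the curl of a test field with the skew-symmetric field, on one tetrahedron. -/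
noncomputable def curlPair (F : Fin 3 → E3 → Fin 3 → ℝ) (w : E3 → Fin 3 → ℝ) (x : E3) : ℝ :=
  (vcurl (F 2) x 1 - vcurl (F 1) x 2) * w x 0 + (vcurl (F 0) x 2 - vcurl (F 2) x 0) * w x 1 +
    (vcurl (F 1) x 0 - vcurl (F 0) x 1) * w x 2

theorem sum_integral_curlPair_eq_zero (hK : IsTetMesh K) (hW : IsAxial K r q W) {v a : E3}
    (hva : v ≠ a) (hq : q ∈ kerC K r v) {m : Finset E3 → Fin 3 → E3 → Fin 3 → ℝ}
    (hm : ∀ T i l, IsPoly r fun x => m T i x l) (hc : TanCompat hK v a m) :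
    ∑ T ∈ hK.star v a, ∫ x in interior (hull T),
      curlPair (fun i y => bubble v a T y • m T i y) (W T) x = 0 := by
  have key := hq.2 _ (edgeField_mem_Mring hva hm hc) _ (hasWeakCurl_edgeField hva hm hc)
  have hF := fun T i l => bubble_smul_contDiff (v := v) (a := a) hm T i l
  rw [← key, cForm]
  symm
  refine hK.integral_star (v := v) (a := a) (fun T => ?_) (fun T hT x hx => ?_)
    fun T hTK hT x hx => ?_
  · have h1 := fun i j => continuous_vcurl (hF T i) j
    have h2 := fun l => (hW.contDiff T l).continuous
    exact ((((h1 2 1).sub (h1 1 2)).mul (h2 0)).add (((h1 0 2).sub (h1 2 0)).mul (h2 1))).add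
      (((h1 1 0).sub (h1 0 1)).mul (h2 2))
  · rw [hW.eq T (star_subset_cells hK v a T hT) x hx, frob_skw_axl]
    simp only [edgeCurl_of_mem hT hx]
    rfl
  · rw [edgeCurl_of_notMem hTK hT hx]
    simp [frob, skw]

/-- In general `curlPair` is `div (Ξ μ) · w`. Here the matrix is `t Fᵀ - ½ (F · t) I`, the factor
`½` being chosen so that the traces cancel in dimension three and `Ξ` maps it to `F tᵀ`. The pairing
is thus `∂_t F · w`. -/
theorem curlPair_edge {F : E3 → Fin 3 → ℝ} {w : E3 → Fin 3 → ℝ} (t : E3)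
    (hF : ∀ l, ContDiff ℝ 1 fun x => F x l) (hw : ∀ l, ContDiff ℝ 1 fun x => w x l) (x : E3) :
    curlPair (fun i y => t i • F y - ((1 / 2 : ℝ) * (F y ⬝ᵥ t.ofLp)) • Pi.single i 1) w x =
      fderiv ℝ (fun y => F y ⬝ᵥ w y) x t - F x ⬝ᵥ fun l => fderiv ℝ (fun y => w y l) x t := by
  have dF : ∀ l, Differentiable ℝ (fun y => F y l) := fun l => (hF l).differentiable one_ne_zero
  have dw : ∀ l, Differentiable ℝ (fun y => w y l) := fun l => (hw l).differentiable one_ne_zero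
  have dFt : Differentiable ℝ fun y => F y ⬝ᵥ t.ofLp :=
    (contDiff_dot_const hF _).differentiable one_ne_zero
  have h1 : ∀ i l k, pgrad (fun y => (t i • F y - ((1 / 2 : ℝ) * (F y ⬝ᵥ t.ofLp)) •
      (Pi.single i 1 : Fin 3 → ℝ)) l) x k = t i * pgrad (fun y => F y l) x k -
        (Pi.single i 1 : Fin 3 → ℝ) l * ((1 / 2) * (t 0 * pgrad (fun y => F y 0) x k
          + t 1 * pgrad (fun y => F y 1) x k + t 2 * pgrad (fun y => F y 2) x k)) := by
    intro i l k
    simp only [Pi.sub_apply, Pi.smul_apply, smul_eq_mul]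
    rw [pgrad_sub ((dF l).const_mul _) ((dFt.const_mul _).mul_const _), pgrad_const_mul (dF l),
      pgrad_mul_const (dFt.const_mul _), pgrad_const_mul dFt, pgrad_dot_const hF]
  have h2 : ∀ k, pgrad (fun y => F y ⬝ᵥ w y) x k =
      (F x 0 * pgrad (fun y => w y 0) x k + w x 0 * pgrad (fun y => F y 0) x k) +
      (F x 1 * pgrad (fun y => w y 1) x k + w x 1 * pgrad (fun y => F y 1) x k) +
      (F x 2 * pgrad (fun y => w y 2) x k + w x 2 * pgrad (fun y => F y 2) x k) := by
    intro k
    simp only [dot3]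
    rw [pgrad_add (((dF 0).fun_mul (dw 0)).fun_add ((dF 1).fun_mul (dw 1)))
      ((dF 2).fun_mul (dw 2)), pgrad_add ((dF 0).fun_mul (dw 0)) ((dF 1).fun_mul (dw 1)),
      pgrad_mul (dF 0) (dw 0), pgrad_mul (dF 1) (dw 1), pgrad_mul (dF 2) (dw 2)]
  rw [fderiv_eq_sum_pgrad, h2, h2, h2]
  simp only [curlPair, vcurl, h1]
  simp only [dot3, fderiv_eq_sum_pgrad]
  simp
  ring

/-- The directional derivative along the edge `v a`. -/
noncomputable def edgeDeriv (W : Finset E3 → E3 → Fin 3 → ℝ) (v a : E3) (T : Finset E3) (x : E3)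
    (l : Fin 3) : ℝ := fderiv ℝ (fun y => W T y l) x (a - v)

theorem IsAxial.edgeDeriv_isPoly (hW : IsAxial K r q W) (v a : E3) (T : Finset E3) (l : Fin 3) :
    IsPoly r fun x => edgeDeriv W v a T x l := (hW.poly T l).fderiv _

theorem edgeDeriv_dot (hW : IsAxial K r q W) (v a : E3) (T : Finset E3) (x : E3) (u : Fin 3 → ℝ) :
    edgeDeriv W v a T x ⬝ᵥ u = fderiv ℝ (fun y => W T y ⬝ᵥ u) x (a - v) := by
  rw [fderiv_eq_sum_pgrad, pgrad_dot_const (hW.contDiff T), pgrad_dot_const (hW.contDiff T),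
    pgrad_dot_const (hW.contDiff T)]
  simp only [dot3, edgeDeriv, fderiv_eq_sum_pgrad]
  ring

/-- The direction `a - v` is tangent to the triangle, so an identity on its relative interior may be
differentiated along it. -/
theorem edgeDeriv_dot_eq (hW : IsAxial K r q W) {v a b : E3} {T T' : Finset E3} {u : Fin 3 → ℝ}
    (h : ∀ s ∈ refTri, (W T (triPt v a b s) - W T' (triPt v a b s)) ⬝ᵥ u = 0) {s : Fin 2 → ℝ}
    (hs : s ∈ refTri) :
    edgeDeriv W v a T (triPt v a b s) ⬝ᵥ u = edgeDeriv W v a T' (triPt v a b s) ⬝ᵥ u := by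
  rw [edgeDeriv_dot hW, edgeDeriv_dot hW, ← sub_eq_zero]
  have hd : ∀ T, DifferentiableAt ℝ (fun y => W T y ⬝ᵥ u) (triPt v a b s) := fun T =>
    (contDiff_dot_const (hW.contDiff T) u).differentiable one_ne_zero _
  have h1 := ((hd T).hasFDerivAt.fun_sub (hd T').hasFDerivAt)
  have h2 : HasDerivAt (fun ε : ℝ => triPt v a b s + ε • (a - v)) (a - v) 0 := by
    simpa using ((hasDerivAt_id (0 : ℝ)).smul_const (a - v)).const_add (triPt v a b s)
  have h3 := HasFDerivAt.comp_hasDerivAt_of_eq (0 : ℝ) h1 h2 (by simp)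
  have h4 : (fun ε : ℝ => s + ε • (Pi.single 0 1 : Fin 2 → ℝ)) ⁻¹' refTri ∈ 𝓝 (0 : ℝ) := by
    refine ContinuousAt.preimage_mem_nhds (by fun_prop) (isOpen_refTri.mem_nhds (by simpa using hs))
  have h5 : (fun _ : ℝ => (0 : ℝ)) =ᶠ[𝓝 0] ((fun y => W T y ⬝ᵥ u - W T' y ⬝ᵥ u) ∘
      fun ε : ℝ => triPt v a b s + ε • (a - v)) := by
    filter_upwards [h4] with ε hε
    have e : triPt v a b s + ε • (a - v) = triPt v a b (s + ε • Pi.single 0 1) := by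
      simp only [triPt, Pi.add_apply, Pi.smul_apply, smul_eq_mul, Pi.single_eq_same, ne_eq,
        one_ne_zero, not_false_eq_true, Pi.single_eq_of_ne]
      module
    simp only [Function.comp, e]
    rw [← sub_dotProduct, h _ hε]
  have h6 := (hasDerivAt_const (0 : ℝ) (0 : ℝ)).congr_of_eventuallyEq h5.symm
  exact h3.unique h6

/-- The test field is built from the derivative itself, so the pairing is minus a weighted sum of
squared `L²` norms with a weight positive inside every cell of the star. -/
theorem edgeDeriv_eq_zero (hK : IsTetMesh K) (hW : IsAxial K r q W) {v a : E3}
    (hva : v ≠ a) (hq : q ∈ kerC K r v) {T : Finset E3} (hT : T ∈ hK.star v a) {x : E3}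
    (hx : x ∈ interior (hull T)) : edgeDeriv W v a T x = 0 := by
  set t : E3 := a - v with ht
  -- The solution of `Ξ m = g tᵀ` for `g = edgeDeriv W v a T`. Differentiation lowers the degree
  -- from `r + 1` to the admissible `r`.
  set m : Finset E3 → Fin 3 → E3 → Fin 3 → ℝ := fun T i x =>
    t i • edgeDeriv W v a T x - ((1 / 2 : ℝ) * (edgeDeriv W v a T x ⬝ᵥ t.ofLp)) • Pi.single i 1
    with hm
  have hg := hW.edgeDeriv_isPoly v a
  have hgt : ∀ T, IsPoly r fun x => edgeDeriv W v a T x ⬝ᵥ t.ofLp := by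
    intro T
    simp only [dot3]
    exact (((hg T 0).mul (IsPoly.const 0 _)).add ((hg T 1).mul (IsPoly.const 0 _))).add
      ((hg T 2).mul (IsPoly.const 0 _))
  have hmp : ∀ T i l, IsPoly r fun x => m T i x l := by
    intro T i l
    have := ((hg T l).const_mul (t i)).sub
      (((hgt T).const_mul (1 / 2)).const_mul ((Pi.single i 1 : Fin 3 → ℝ) l))
    simpa [hm, mul_comm] using this
  have hcompat : TanCompat hK v a m := by
    intro T hT T' hT' hne b hvb hab hbT hbT' s hs i
    obtain ⟨hTK, hvT, haT⟩ := hK.mem_star.1 hT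
    obtain ⟨hTK', hvT', haT'⟩ := hK.mem_star.1 hT'
    obtain ⟨d, hd⟩ := (isTet_of_mem_cells hTK).exists_labeled_of_three hvT haT hbT hva hvb hab
    obtain ⟨d', hd'⟩ := (isTet_of_mem_cells hTK').exists_labeled_of_three hvT' haT' hbT' hva hvb hab
    have e1 := edgeDeriv_dot_eq hW (fun s hs =>
      (hW.tangential_eq hK hq.1.2.2 hTK hTK' hne hd hd' hs).1) hs
    have e2 := edgeDeriv_dot_eq hW (fun s hs =>
      (hW.tangential_eq hK hq.1.2.2 hTK hTK' hne hd hd' hs).2) hs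
    simp only [hm, sub_dotProduct, smul_dotProduct, ht, e1, e2, and_self]
  have key := sum_integral_curlPair_eq_zero hK hW hva hq hmp hcompat
  have hgc : ∀ T l, ContDiff ℝ 1 fun x => (bubble v a T x • edgeDeriv W v a T x) l := fun T l =>
    ((bubble_isPoly v a T).mul (hg T l)).contDiff.of_le (by exact_mod_cast le_top)
  have hcont : ∀ T, Continuous fun x =>
      bubble v a T x * (edgeDeriv W v a T x ⬝ᵥ edgeDeriv W v a T x) := by
    intro T
    simp only [dot3]
    have h := fun l => (hg T l).contDiff.continuous
    exact (bubble_isPoly v a T).contDiff.continuous.mul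
      ((((h 0).mul (h 0)).add ((h 1).mul (h 1))).add ((h 2).mul (h 2)))
  have hterm : ∀ T ∈ hK.star v a, ∫ x in interior (hull T),
      curlPair (fun i y => bubble v a T y • m T i y) (W T) x =
      - ∫ x in interior (hull T),
        bubble v a T x * (edgeDeriv W v a T x ⬝ᵥ edgeDeriv W v a T x) := by
    intro T hT
    obtain ⟨hTK, hvT, haT⟩ := hK.mem_star.1 hT
    obtain ⟨b, d, h⟩ := (isTet_of_mem_cells hTK).exists_labeled_of_two hvT haT hva
    have hFW : ContDiff ℝ 1 fun y => (bubble v a T y • edgeDeriv W v a T y) ⬝ᵥ W T y := by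
      simp only [dot3]
      exact (((hgc T 0).mul (hW.contDiff T 0)).add ((hgc T 1).mul (hW.contDiff T 1))).add
        ((hgc T 2).mul (hW.contDiff T 2))
    have e1 : ∀ x, curlPair (fun i y => bubble v a T y • m T i y) (W T) x =
        fderiv ℝ (fun y => (bubble v a T y • edgeDeriv W v a T y) ⬝ᵥ W T y) x t -
          bubble v a T x * (edgeDeriv W v a T x ⬝ᵥ edgeDeriv W v a T x) := by
      intro x
      have := curlPair_edge t (hgc T) (hW.contDiff T) x
      have e2 : (fun (i : Fin 3) y => t i • bubble v a T y • edgeDeriv W v a T y -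
          ((1 / 2 : ℝ) * ((bubble v a T y • edgeDeriv W v a T y) ⬝ᵥ t.ofLp)) •
            (Pi.single i 1 : Fin 3 → ℝ)) = fun i y => bubble v a T y • m T i y := by
        funext i y
        simp only [hm, smul_dotProduct, smul_eq_mul]
        module
      rw [e2] at this
      rw [this, smul_dotProduct, smul_eq_mul]
      rfl
    simp only [e1]
    rw [integral_sub (integrableOn_interior_hull T
        ((hFW.continuous_fderiv one_ne_zero).clm_apply continuous_const))
      (integrableOn_interior_hull T (hcont T)), ht,
      integral_tet_fderiv h.rotate hFW fun x hx => by simp [bubble, hx]]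
    -- The triangle `v b d` is opposite `a`, so the factor `λ_a` of the bubble vanishes on it.
    have e3 : triInt v b d (fun y => (bubble v a T y • edgeDeriv W v a T y) ⬝ᵥ W T y) = 0 :=
      (triInt_congr (g := fun _ => 0) fun s _ => by
        simp [bubble, bary_triPt_facet h.rotate s]).trans (by simp [triInt])
    rw [e3]
    ring
  rw [Finset.sum_congr rfl hterm, Finset.sum_neg_distrib, neg_eq_zero] at key
  have hbpos : ∀ T ∈ hK.star v a, ∀ x ∈ interior (hull T), 0 < bubble v a T x := by
    intro T hT x hx
    obtain ⟨hTK, hvT, haT⟩ := hK.mem_star.1 hT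
    have h := (mem_interior_hull_iff (isTet_of_mem_cells hTK)).1 hx
    exact mul_pos (h v hvT) (h a haT)
  have hsq : ∀ u : Fin 3 → ℝ, 0 ≤ u ⬝ᵥ u := fun u => by
    rw [dot3]; nlinarith [sq_nonneg (u 0), sq_nonneg (u 1), sq_nonneg (u 2)]
  have hnn : ∀ T ∈ hK.star v a, ∀ x ∈ interior (hull T),
      0 ≤ bubble v a T x * (edgeDeriv W v a T x ⬝ᵥ edgeDeriv W v a T x) := fun T hT x hx =>
    mul_nonneg (hbpos T hT x hx).le (hsq _)
  rw [Finset.sum_eq_zero_iff_of_nonneg fun T hT =>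
    setIntegral_nonneg isOpen_interior.measurableSet (hnn T hT)] at key
  have h1 := key T hT
  rw [setIntegral_eq_zero_iff_of_nonneg_ae ((ae_restrict_iff' isOpen_interior.measurableSet).2
    (Eventually.of_forall (hnn T hT))) (integrableOn_interior_hull T (hcont T))] at h1
  have h2 := Measure.eqOn_open_of_ae_eq h1 isOpen_interior (hcont T).continuousOn
    continuousOn_const hx
  have h3 := (mul_eq_zero.1 h2).resolve_left (hbpos T hT x hx).ne'
  exact dotProduct_self_eq_zero.1 h3

theorem exists_const_of_mem_patch (hK : IsTetMesh K) (hW : IsAxial K r q W) {v : E3}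
    (hq : q ∈ kerC K r v) {T : Finset E3} (hT : T ∈ patchCells K v) :
    ∃ C : Fin 3 → ℝ, ∀ x ∈ interior (hull T), W T x = C := by
  obtain ⟨hTK, hvT⟩ := hT
  have hTet := isTet_of_mem_cells hTK
  have h0 : ∀ l, ∀ x ∈ interior (hull T), fderiv ℝ (fun y => W T y l) x = 0 := by
    intro l x hx
    ext t
    -- The edges at `v` span: barycentric coordinates sum to one, so `v` may be subtracted in every
    -- term.
    have e1 : t = ∑ p ∈ T, bary T p (v + t) • (p - v) := by
      simp only [smul_sub, Finset.sum_sub_distrib, ← Finset.sum_smul, sum_bary hTet,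
        sum_bary_smul hTet]
      simp
    rw [e1, map_sum]
    refine Finset.sum_eq_zero fun p hp => ?_
    rw [map_smul]
    by_cases hpv : v = p
    · simp [hpv]
    · have := congrFun (edgeDeriv_eq_zero hK hW hpv hq (hK.mem_star.2 ⟨hTK, hvT, hp⟩) hx) l
      rw [edgeDeriv] at this
      rw [this]
      simp
  have hne : (interior (hull T)).Nonempty := by
    obtain ⟨a, b, d, h⟩ := hTet.exists_labeled_of_one hvT
    exact ⟨_, (mem_interior_hull_triPt h (fun _ => 1 / 4) (1 / 4)).2
      ⟨by norm_num, by norm_num, by norm_num, by norm_num⟩⟩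
  obtain ⟨x0, hx0⟩ := hne
  refine ⟨W T x0, fun x hx => funext fun l => ?_⟩
  exact isOpen_interior.is_const_of_fderiv_eq_zero
    ((convex_convexHull ℝ _).interior.isPreconnected)
    ((hW.contDiff T l).differentiable one_ne_zero).differentiableOn (h0 l) hx hx0

end Gradient

/-! ### Jumps of a piecewise constant field across facets -/

section Jump

variable {K : Geometry.SimplicialComplex ℝ E3} {r : ℕ} {q : E3 → Mat3}
  {W : Finset E3 → E3 → Fin 3 → ℝ}

/-- The gradient of the barycentric coordinate of `T` at `b`. -/
noncomputable def baryGrad (T : Finset E3) (b : E3) : Fin 3 → ℝ :=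
  fun l => (bary T b).linear (EuclideanSpace.single l 1)

theorem baryGrad_dot (T : Finset E3) (b t : E3) : baryGrad T b ⬝ᵥ t.ofLp = (bary T b).linear t := by
  have h2 : t = ∑ l, t l • EuclideanSpace.single l (1 : ℝ) := by
    ext j; simp [Finset.sum_apply, Pi.single_apply]
  conv_rhs => rw [h2]
  simp [baryGrad, dot3, Fin.sum_univ_three, mul_comm]

theorem baryGrad_dot_sub {T : Finset E3} (hT : IsTet T) {v b p : E3} (hv : v ∈ T) (hp : p ∈ T)
    (hvb : v ≠ b) [Decidable (p = b)] :
    baryGrad T b ⬝ᵥ (p - v).ofLp = if p = b then 1 else 0 := by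
  rw [baryGrad_dot, bary_linear_sub, bary_ne hT hv hvb, sub_zero]
  split_ifs with h
  · subst h; exact bary_self hT hp
  · exact bary_ne hT hp h

/-- With `c`, `g`, `C` constant only `φ` is differentiated, and the pairing is the divergence of a
field whose facet fluxes are explicit. -/
theorem curlPair_const {φ : E3 → ℝ} (hφ : ContDiff ℝ 1 φ) {w : E3 → Fin 3 → ℝ} (g c C : Fin 3 → ℝ)
    {x : E3} (hw : w x = C) : curlPair (fun i y => φ y • c i • g) w x =
      vdiv (fun y => φ y • (g ⨯₃ (c ⨯₃ C))) x := by
  have dφ := hφ.differentiable one_ne_zero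
  have h : ∀ (u : Fin 3 → ℝ) l k, pgrad (fun y => (φ y • u) l) x k = u l * pgrad φ x k := by
    intro u l k
    simp only [Pi.smul_apply, smul_eq_mul]
    rw [pgrad_mul_const dφ]
  simp only [curlPair, vcurl, vdiv, Fin.sum_univ_three, h, hw]
  simp [cross_zero', cross_one', cross_two']
  ring

theorem triInt_bubble_pos {T : Finset E3} {v a b d : E3} (h : Labeled T v a b d) :
    0 < triInt v a b (bubble v a T) := by
  have hc : Continuous (bubble v a T) := (bubble_isPoly v a T).contDiff.continuous
  have hpos : ∀ s ∈ refTri, 0 < bubble v a T (triPt v a b s) := fun s hs =>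
    mul_pos (bary_triPt_pos h hs (by simp)) (bary_triPt_pos h hs (by simp))
  rw [triInt, setIntegral_pos_iff_support_of_nonneg_ae
    ((ae_restrict_iff' isOpen_refTri.measurableSet).2
      (Eventually.of_forall fun s hs => (hpos s hs).le))
    (integrableOn_refTri (hc.comp (triPt_continuous v a b)))]
  have : Function.support (fun s => bubble v a T (triPt v a b s)) ∩ refTri = refTri :=
    Set.inter_eq_right.2 fun s hs => (hpos s hs).ne'
  rw [this]
  exact isOpen_refTri.measure_pos _ ⟨fun _ => 1 / 4, by norm_num [refTri]⟩

/-- The test field is `λ_v λ_a c ⊗ ∇λ_b`. It is admissible for every `r` because `∇λ_b` is constant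
on cells with single-valued tangential components. Those components along `a - v` and `p - v` are
`0` and `δ_{pb}`, so among the facets `v a p` only `p = b` carries flux. -/
theorem sum_orient_eq_zero (hK : IsTetMesh K) (hW : IsAxial K r q W) {v : E3}
    (hq : q ∈ kerC K r v) {C : Finset E3 → Fin 3 → ℝ}
    (hC : ∀ T ∈ patchCells K v, ∀ x ∈ interior (hull T), W T x = C T) {a b : E3} (hva : v ≠ a)
    (hvb : v ≠ b) (hab : a ≠ b) (c : Fin 3 → ℝ) :
    ∑ T ∈ hK.star v a with b ∈ T, orient v a b T * ((c ⨯₃ C T) ⬝ᵥ (a - v).ofLp) = 0 := by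
  classical
  set m : Finset E3 → Fin 3 → E3 → Fin 3 → ℝ := fun T i _ => c i • baryGrad T b with hm
  have hmp : ∀ T i l, IsPoly r fun x => m T i x l := fun T i l => IsPoly.const _ _
  have hcompat : TanCompat hK v a m := by
    intro T hT T' hT' hne p hvp hap hpT hpT' s hs i
    obtain ⟨hTK, hvT, haT⟩ := hK.mem_star.1 hT
    obtain ⟨hTK', hvT', haT'⟩ := hK.mem_star.1 hT'
    simp only [hm, smul_dotProduct, baryGrad_dot_sub (isTet_of_mem_cells hTK) hvT haT hvb,
      baryGrad_dot_sub (isTet_of_mem_cells hTK') hvT' haT' hvb,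
      baryGrad_dot_sub (isTet_of_mem_cells hTK) hvT hpT hvb,
      baryGrad_dot_sub (isTet_of_mem_cells hTK') hvT' hpT' hvb, and_self]
  have key := sum_integral_curlPair_eq_zero hK hW hva hq hmp hcompat
  have hb1 : ∀ T, ContDiff ℝ 1 (bubble v a T) := fun T =>
    (bubble_isPoly v a T).contDiff.of_le (by exact_mod_cast le_top)
  set Z : Finset E3 → E3 → Fin 3 → ℝ := fun T y =>
    bubble v a T y • (baryGrad T b ⨯₃ (c ⨯₃ C T)) with hZ
  have e1 : ∀ T ∈ hK.star v a, ∫ x in interior (hull T),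
      curlPair (fun i y => bubble v a T y • m T i y) (W T) x =
      ∫ x in interior (hull T), vdiv (Z T) x := by
    intro T hT
    obtain ⟨hTK, hvT, haT⟩ := hK.mem_star.1 hT
    exact setIntegral_congr_fun isOpen_interior.measurableSet fun x hx =>
      curlPair_const (hb1 T) (baryGrad T b) c (C T) (hC T ⟨hTK, hvT⟩ x hx)
  rw [Finset.sum_congr rfl e1, hK.sum_star_integral_vdiv (Z := Z) hva
    (fun T l => (hb1 T).mul contDiff_const)
    (fun T _ x hx => by simp [hZ, bubble, hx]) (fun T _ x hx => by simp [hZ, bubble, hx]),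
    neg_eq_zero] at key
  have e2 : ∀ p, v ≠ p → a ≠ p → ∀ T ∈ hK.star v a, p ∈ T →
      triInt v a p (fun x => Z T x ⬝ᵥ triNormal v a p) =
        (if p = b then -1 else 0) * ((c ⨯₃ C T) ⬝ᵥ (a - v).ofLp) * triInt v a p (bubble v a T) := by
    intro p hvp hap T hT hpT
    obtain ⟨hTK, hvT, haT⟩ := hK.mem_star.1 hT
    rw [← triInt_const_mul]
    congr 1
    funext x
    simp only [hZ, smul_dotProduct, cross_dot_triNormal, smul_eq_mul,
      baryGrad_dot_sub (isTet_of_mem_cells hTK) hvT haT hvb,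
      baryGrad_dot_sub (isTet_of_mem_cells hTK) hvT hpT hvb, hab, if_false]
    split_ifs <;> ring
  by_cases hne : ((hK.star v a).filter fun T => b ∈ T).Nonempty
  swap
  · rw [Finset.not_nonempty_iff_eq_empty.1 hne, Finset.sum_empty]
  obtain ⟨T0, hT0⟩ := hne
  obtain ⟨hT0, hbT0⟩ := Finset.mem_filter.1 hT0
  obtain ⟨hTK0, hvT0, haT0⟩ := hK.mem_star.1 hT0
  obtain ⟨d0, hd0⟩ := (isTet_of_mem_cells hTK0).exists_labeled_of_three hvT0 haT0 hbT0 hva hvb hab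
  rw [Finset.sum_eq_single_of_mem b] at key
  · have e3 : ∀ T ∈ (hK.star v a).filter fun T => b ∈ T,
        orient v a b T * triInt v a b (fun x => Z T x ⬝ᵥ triNormal v a b) =
        (orient v a b T * ((c ⨯₃ C T) ⬝ᵥ (a - v).ofLp)) * - triInt v a b (bubble v a T0) := by
      intro T hT
      obtain ⟨hT, hbT⟩ := Finset.mem_filter.1 hT
      obtain ⟨hTK, hvT, haT⟩ := hK.mem_star.1 hT
      obtain ⟨d, hd⟩ := (isTet_of_mem_cells hTK).exists_labeled_of_three hvT haT hbT hva hvb hab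
      -- The bubble restricts to the same function on the facet from every cell, giving a common
      -- nonzero factor that can be divided out.
      have e4 : triInt v a b (bubble v a T) = triInt v a b (bubble v a T0) :=
        triInt_congr fun s _ => by rw [bubble_eq_of_facet hd, bubble_eq_of_facet hd0]
      rw [e2 b hvb hab T hT hbT, if_pos rfl, e4]
      ring
    rw [Finset.sum_congr rfl e3, ← Finset.sum_mul] at key
    exact (mul_eq_zero.1 key).resolve_right (neg_ne_zero.2 (triInt_bubble_pos hd0).ne')
  · simp only [Finset.mem_filter, Finset.mem_biUnion, id]
    exact ⟨⟨T0, hT0, hbT0⟩, hvb, hab⟩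
  · intro p hp hpb
    obtain ⟨hvp, hap⟩ := (Finset.mem_filter.1 hp).2
    refine Finset.sum_eq_zero fun T hT => ?_
    obtain ⟨hT, hpT⟩ := Finset.mem_filter.1 hT
    rw [e2 p hvp hap T hT hpT, if_neg hpb]
    ring

theorem mul_comm_of_forall_cross_dot {x w : Fin 3 → ℝ}
    (hx : ∀ c : Fin 3 → ℝ, (c ⨯₃ w) ⬝ᵥ x = 0) (l m : Fin 3) : w l * x m = w m * x l := by
  have hx0 := hx (Pi.single 0 1)
  have hx1 := hx (Pi.single 1 1)
  have hx2 := hx (Pi.single 2 1)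
  simp [dot3, cross_zero', cross_one', cross_two'] at hx0 hx1 hx2
  fin_cases l <;> fin_cases m <;> simp <;> linarith

/-- The hypotheses say that `w` is parallel to both `x` and `y`, which are linearly independent. -/
theorem eq_zero_of_forall_cross_dot {x y w : Fin 3 → ℝ} (hN : x ⨯₃ y ≠ 0)
    (hx : ∀ c : Fin 3 → ℝ, (c ⨯₃ w) ⬝ᵥ x = 0) (hy : ∀ c : Fin 3 → ℝ, (c ⨯₃ w) ⬝ᵥ y = 0) :
    w = 0 := by
  obtain ⟨j, hj⟩ := Function.ne_iff.1 hN
  funext l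
  refine (mul_eq_zero.1 (?_ : (x ⨯₃ y) j * w l = 0)).resolve_left hj
  rw [cross_cyclic]
  linear_combination y (j + 2) * mul_comm_of_forall_cross_dot hx l (j + 1)
    - y (j + 1) * mul_comm_of_forall_cross_dot hx l (j + 2)
    + x l * mul_comm_of_forall_cross_dot hy (j + 1) (j + 2)

/-- `sum_orient_eq_zero` is applied to `(a, b)` and to `(b, a)`: the facet is the same, but the
tested direction changes from `a - v` to `b - v`. Together they annihilate the jump, or the value
itself if no second cell contains the facet. -/
theorem facet_dichotomy (hK : IsTetMesh K) (hW : IsAxial K r q W) {v : E3}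
    (hq : q ∈ kerC K r v) {C : Finset E3 → Fin 3 → ℝ}
    (hC : ∀ T ∈ patchCells K v, ∀ x ∈ interior (hull T), W T x = C T) {T : Finset E3}
    (hT : T ∈ cells K) {a b d : E3} (h : Labeled T v a b d) :
    (∃ T' ∈ cells K, T ≠ T' ∧ (∃ d', Labeled T' v a b d') ∧ C T' = C T) ∨ C T = 0 := by
  classical
  have hTs : T ∈ hK.star v a := hK.mem_star.2 ⟨hT, h.mem_v, h.mem_a⟩
  have hset : (hK.star v b).filter (fun S => a ∈ S) = (hK.star v a).filter fun S => b ∈ S := by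
    ext S
    simp only [Finset.mem_filter, hK.mem_star]
    tauto
  have h1 := sum_orient_eq_zero hK hW hq hC h.va h.vb h.ab
  have h2 := sum_orient_eq_zero hK hW hq hC h.vb h.va h.ab.symm
  rw [hset] at h2
  have hTo := orient_ne_zero h
  have hTo' : orient v b a T ≠ 0 := orient_ne_zero h.rotate.swap
  by_cases hex : ∃ T' ∈ cells K, T ≠ T' ∧ v ∈ T' ∧ a ∈ T' ∧ b ∈ T'
  · left
    obtain ⟨T', hT', hne, hv', ha', hb'⟩ := hex
    obtain ⟨d', h'⟩ := (isTet_of_mem_cells hT').exists_labeled_of_three hv' ha' hb' h.va h.vb h.ab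
    have hpair : ((hK.star v a).filter fun S => b ∈ S) = {T, T'} := by
      ext S
      simp only [Finset.mem_filter, Finset.mem_insert, Finset.mem_singleton]
      constructor
      · rintro ⟨hS, hbS⟩
        obtain ⟨hSK, hvS, haS⟩ := hK.mem_star.1 hS
        obtain ⟨e, he⟩ :=
          (isTet_of_mem_cells hSK).exists_labeled_of_three hvS haS hbS h.va h.vb h.ab
        exact cell_eq_or_eq_of_facet hT hT' hSK hne h h' he
      · rintro (rfl | rfl)
        exacts [⟨hTs, h.mem_b⟩, ⟨hK.mem_star.2 ⟨hT', hv', ha'⟩, hb'⟩]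
    refine ⟨T', hT', hne, ⟨d', h'⟩, ?_⟩
    rw [eq_comm, ← sub_eq_zero]
    refine eq_zero_of_forall_cross_dot (triNormal_ne_zero h) (fun c => ?_) fun c => ?_
    · have := h1 c
      rw [hpair, Finset.sum_pair hne, orient_add_orient hT hT' hne h h'] at this
      refine (mul_eq_zero.1 (?_ : orient v a b T * _ = 0)).resolve_left hTo
      rw [map_sub, sub_dotProduct]
      linarith
    · have := h2 c
      rw [hpair, Finset.sum_pair hne,
        orient_add_orient hT hT' hne h.rotate.swap h'.rotate.swap] at this
      refine (mul_eq_zero.1 (?_ : orient v b a T * _ = 0)).resolve_left hTo'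
      rw [map_sub, sub_dotProduct]
      linarith
  · right
    push Not at hex
    have hsing : ((hK.star v a).filter fun S => b ∈ S) = {T} := by
      ext S
      simp only [Finset.mem_filter, Finset.mem_singleton, hK.mem_star]
      constructor
      · rintro ⟨⟨hSK, hvS, haS⟩, hbS⟩
        by_contra hne
        exact hex S hSK (Ne.symm hne) hvS haS hbS
      · rintro rfl
        exact ⟨⟨hT, h.mem_v, h.mem_a⟩, h.mem_b⟩
    simp only [hsing, Finset.sum_singleton] at h1 h2
    exact eq_zero_of_forall_cross_dot (triNormal_ne_zero h)
      (fun c => (mul_eq_zero.1 (h1 c)).resolve_left hTo)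
      fun c => (mul_eq_zero.1 (h2 c)).resolve_left hTo'

end Jump

/-! ### Connectivity of the patch through facets -/

section Patch

variable {K : Geometry.SimplicialComplex ℝ E3}

/-- The cone with apex `v` spanned by the tetrahedron `T`. -/
def cone (v : E3) (T : Finset E3) : Set E3 := {x | ∀ p ∈ T, p ≠ v → 0 ≤ bary T p x}

theorem isClosed_cone (v : E3) (T : Finset E3) : IsClosed (cone v T) := by
  have : cone v T = ⋂ p ∈ T, ⋂ _ : p ≠ v, {x | 0 ≤ bary T p x} := by
    ext x; simp [cone]
  rw [this]
  exact isClosed_iInter fun p => isClosed_iInter fun _ => isClosed_iInter fun _ =>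
    isClosed_le continuous_const (bary_continuous T p)

theorem mem_cone_iff {T : Finset E3} {v a b d : E3} (h : Labeled T v a b d) {x : E3} :
    x ∈ cone v T ↔ 0 ≤ bary T a x ∧ 0 ≤ bary T b x ∧ 0 ≤ bary T d x := by
  simp only [cone, Set.mem_ofPred_eq]
  rw [h.forall_iff]
  have h1 := h.va.symm
  have h2 := h.vb.symm
  have h3 := h.vd.symm
  simp [h1, h2, h3]

theorem cone_mem_nhds {T : Finset E3} {v a b d : E3} (h : Labeled T v a b d) {x : E3}
    (ha : 0 < bary T a x) (hb : 0 < bary T b x) (hd : 0 < bary T d x) : cone v T ∈ 𝓝 x := by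
  have h1 : ∀ p, 0 < bary T p x → ∀ᶠ y in 𝓝 x, 0 < bary T p y := fun p hp =>
    (bary_continuous T p).continuousAt.eventually_const_lt hp
  filter_upwards [h1 a ha, h1 b hb, h1 d hd] with y h2 h3 h4
  exact (mem_cone_iff h).2 ⟨h2.le, h3.le, h4.le⟩

theorem sub_eq_of_labeled {T : Finset E3} {v a b d : E3} (h : Labeled T v a b d) (x : E3) :
    x - v = bary T a x • (a - v) + bary T b x • (b - v) + bary T d x • (d - v) := by
  have h1 := sum_bary h.tet x
  have h2 := sum_bary_smul h.tet x
  rw [h.sum_eq] at h1 h2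
  have h3 : bary T v x = 1 - bary T a x - bary T b x - bary T d x := by linarith
  rw [h3] at h2
  conv_lhs => rw [← h2]
  module

/-- Near a point in the relative interior of the cone over a shared facet, the coordinates at `a`
and `b` stay positive for both cells, and one of the two remaining coordinates is nonnegative. -/
theorem cone_union_mem_nhds {T T' : Finset E3} (hT : T ∈ cells K) (hT' : T' ∈ cells K)
    (hne : T ≠ T') {v a b d d' : E3} (h : Labeled T v a b d) (h' : Labeled T' v a b d') {x : E3}
    (ha : 0 < bary T a x) (hb : 0 < bary T b x) (hd : bary T d x = 0) :
    cone v T ∪ cone v T' ∈ 𝓝 x := by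
  have hx : x = triPt v a b ![bary T a x, bary T b x] + (0 : ℝ) • (d' - v) := by
    have := sub_eq_of_labeled h x
    rw [hd, zero_smul, add_zero, sub_eq_iff_eq_add'] at this
    simp only [triPt, Matrix.cons_val_zero, Matrix.cons_val_one, zero_smul, add_zero]
    rw [add_assoc]
    exact this
  have ha' : 0 < bary T' a x := by
    rw [hx, bary_triPt, bary_ne h'.tet h'.mem_v h'.va, bary_self h'.tet h'.mem_a,
      bary_ne h'.tet h'.mem_b h'.ab.symm]
    simpa using ha
  have hb' : 0 < bary T' b x := by
    rw [hx, bary_triPt, bary_ne h'.tet h'.mem_v h'.vb, bary_self h'.tet h'.mem_b,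
      bary_ne h'.tet h'.mem_a h'.ab]
    simpa using hb
  have h1 : ∀ T p, 0 < bary T p x → ∀ᶠ y in 𝓝 x, 0 < bary T p y := fun T p hp =>
    (bary_continuous T p).continuousAt.eventually_const_lt hp
  filter_upwards [h1 T a ha, h1 T b hb, h1 T' a ha', h1 T' b hb'] with y h2 h3 h4 h5
  refine (bary_nonneg_or_bary_nonneg hT hT' hne h h' y).imp (fun h6 => ?_) fun h6 => ?_
  · exact (mem_cone_iff h).2 ⟨h2.le, h3.le, h6⟩
  · exact (mem_cone_iff h').2 ⟨h4.le, h5.le, h6⟩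

theorem volume_span_pair_eq_zero (v u w : E3) :
    volume {x : E3 | x - v ∈ Submodule.span ℝ {u, w}} = 0 := by
  classical
  have hne : AffineSubspace.mk' v (Submodule.span ℝ {u, w}) ≠ ⊤ := by
    intro htop
    have h1 := congrArg AffineSubspace.direction htop
    rw [AffineSubspace.direction_mk', AffineSubspace.direction_top] at h1
    have h2 := finrank_span_finset_le_card (R := ℝ) ({u, w} : Finset E3)
    rw [Set.finrank, Finset.coe_pair, h1, finrank_top, finrank_euclideanSpace_fin] at h2
    have h3 := Finset.card_le_two (a := u) (b := w)
    omega
  refine (congrArg volume (Set.ext fun x => ?_)).trans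
    (Measure.addHaar_affineSubspace (volume : Measure E3) _ hne)
  simp [AffineSubspace.mem_mk']

/-- Finitely many sets, each contained in a plane through `v`, cannot cover an open set. Choosing
the endpoint off these planes keeps a segment away from the rays over edges. -/
theorem exists_mem_interior_hull_generic {T : Finset E3} (hne : (interior (hull T)).Nonempty)
    (P : Finset E3) (v u : E3) :
    ∃ x ∈ interior (hull T), ∀ p ∈ P, x - v ∉ Submodule.span ℝ {u, p - v} := by
  by_contra! hcon
  have h1 : interior (hull T) ⊆ ⋃ p ∈ P, {x : E3 | x - v ∈ Submodule.span ℝ {u, p - v}} := by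
    intro x hx
    obtain ⟨p, hp, hxp⟩ := hcon x hx
    exact Set.mem_biUnion hp hxp
  have h2 : volume (interior (hull T)) = 0 :=
    measure_mono_null h1 ((measure_biUnion_null_iff P.countable_toSet).2 fun p _ =>
      volume_span_pair_eq_zero v u (p - v))
  exact (isOpen_interior.measure_pos volume hne).ne' h2

theorem interior_hull_nonempty {T : Finset E3} (hT : IsTet T) {v : E3} (hv : v ∈ T) :
    (interior (hull T)).Nonempty := by
  obtain ⟨a, b, d, h⟩ := hT.exists_labeled_of_one hv
  exact ⟨_, (mem_interior_hull_triPt h (fun _ => 1 / 4) (1 / 4)).2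
    ⟨by norm_num, by norm_num, by norm_num, by norm_num⟩⟩

/-- Contracting towards `v` preserves the cone and the interior of `T`, and eventually brings a
point of `cone v S` into the cell `S` itself. -/
theorem cell_eq_of_mem_cone {T S : Finset E3} (hT : T ∈ cells K) (hS : S ∈ cells K) {v x : E3}
    (hvT : v ∈ T) (hvS : v ∈ S) (hxS : x ∈ cone v S) (hxT : x ∈ interior (hull T)) : T = S := by
  set β := bary S v x
  -- Small enough that the contracted coordinate at `v`, namely `1 - ε + ε β`, is nonnegative.
  set ε : ℝ := 1 / (2 + |β|) with hε
  have hpos : 0 < 2 + |β| := by positivity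
  have hε0 : 0 < ε := by positivity
  have hε1 : ε < 1 := by
    rw [hε, div_lt_one hpos]; linarith [abs_nonneg β]
  have hbary : ∀ U : Finset E3, ∀ p, bary U p (v + ε • (x - v)) =
      (1 - ε) * bary U p v + ε * bary U p x := by
    intro U p
    rw [bary_add_smul, bary_linear_sub]
    ring
  refine cell_eq_of_mem_interior hS hT (x := v + ε • (x - v)) ?_ ?_
  · rw [mem_hull_iff (isTet_of_mem_cells hS)]
    intro p hp
    rw [hbary]
    by_cases hpv : p = v
    · subst hpv
      rw [bary_self (isTet_of_mem_cells hS) hp]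
      have h1 : (1 - ε) * 1 + ε * bary S p x = ε * (1 + |β| + β) := by
        rw [hε]
        change (1 - 1 / (2 + |β|)) * 1 + 1 / (2 + |β|) * β = _
        field_simp
        ring
      rw [h1]
      have := neg_abs_le β
      exact mul_nonneg hε0.le (by linarith)
    · rw [bary_ne (isTet_of_mem_cells hS) hvS (Ne.symm hpv), mul_zero, zero_add]
      exact mul_nonneg hε0.le (hxS p hp hpv)
  · have hT' := isTet_of_mem_cells hT
    rw [mem_interior_hull_iff hT'] at hxT ⊢
    intro p hp
    rw [hbary]
    have h1 := mul_pos hε0 (hxT p hp)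
    by_cases hpv : p = v
    · subst hpv
      rw [bary_self hT' hp]
      linarith
    · rw [bary_ne hT' hvT (Ne.symm hpv)]
      linarith

/-- Since `C T₁ ≠ 0`, cells with this value always have a neighbour of the same value across each
facet at `v`. On a segment avoiding the rays over edges, the union `U` of their cones is closed and
cannot be exited, so it reaches the interior of `T₂`. -/
theorem const_of_facet_dichotomy {R : Type*} [Zero R] (hK : IsTetMesh K) {v : E3}
    {C : Finset E3 → R}
    (hC : ∀ T ∈ patchCells K v, ∀ a b d, Labeled T v a b d →
      (∃ T' ∈ cells K, T ≠ T' ∧ (∃ d', Labeled T' v a b d') ∧ C T' = C T) ∨ C T = 0)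
    {T₁ T₂ : Finset E3} (hT₁ : T₁ ∈ patchCells K v) (hT₂ : T₂ ∈ patchCells K v) (h0 : C T₁ ≠ 0) :
    C T₂ = C T₁ := by
  classical
  obtain ⟨hT₁K, hv₁⟩ := hT₁
  obtain ⟨hT₂K, hv₂⟩ := hT₂
  set S := hK.cellFinset.filter fun T => v ∈ T ∧ C T = C T₁ with hS
  have hmemS : ∀ {T}, T ∈ S ↔ T ∈ cells K ∧ v ∈ T ∧ C T = C T₁ := by
    intro T; simp [hS, hK.mem_cellFinset]
  set U : Set E3 := ⋃ T ∈ S, cone v T with hU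
  have hsubU : ∀ {T}, T ∈ S → cone v T ⊆ U := fun hT => Set.subset_biUnion_of_mem hT
  have hUc : IsClosed U := S.finite_toSet.isClosed_biUnion fun T _ => isClosed_cone v T
  obtain ⟨x₁, hx₁⟩ := interior_hull_nonempty (isTet_of_mem_cells hT₁K) hv₁
  obtain ⟨x₂, hx₂, hgen⟩ := exists_mem_interior_hull_generic
    (interior_hull_nonempty (isTet_of_mem_cells hT₂K) hv₂) (hK.cellFinset.biUnion id) v (x₁ - v)
  have hT₁S : T₁ ∈ S := hmemS.2 ⟨hT₁K, hv₁, rfl⟩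
  set γ : ℝ → E3 := fun t => x₁ + t • (x₂ - x₁) with hγ
  have hγc : Continuous γ := by fun_prop
  have hU1 : U ∈ 𝓝 x₁ := by
    obtain ⟨a, b, d, h⟩ := (isTet_of_mem_cells hT₁K).exists_labeled_of_one hv₁
    have hp := (mem_interior_hull_iff h.tet).1 hx₁
    exact mem_of_superset (cone_mem_nhds h (hp a h.mem_a) (hp b h.mem_b) (hp d h.mem_d))
      (hsubU hT₁S)
  have hstep : ∀ t ∈ Set.Ico (0 : ℝ) 1, γ t ∈ U → U ∈ 𝓝 (γ t) := by
    rintro t ⟨ht0, ht1⟩ htU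
    rcases ht0.eq_or_lt with rfl | ht0
    · simpa [hγ] using hU1
    obtain ⟨T, hTS, hyT⟩ := Set.mem_iUnion₂.1 htU
    obtain ⟨hTK, hvT, hCT⟩ := hmemS.1 hTS
    -- A point on the ray over `a`, or the apex itself, at a parameter `t > 0` would put `x₂ - v` in
    -- the span of `x₁ - v` and `a - v`, against the choice of `x₂`.
    have hray : ∀ a b d, Labeled T v a b d → ¬ (bary T b (γ t) = 0 ∧ bary T d (γ t) = 0) := by
      rintro a b d h ⟨hb, hd⟩
      have e := sub_eq_of_labeled h (γ t)
      rw [hb, hd, zero_smul, zero_smul, add_zero, add_zero] at e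
      refine hgen a (Finset.mem_biUnion.2 ⟨T, hK.mem_cellFinset.2 hTK, h.mem_a⟩) ?_
      rw [Submodule.mem_span_pair]
      refine ⟨-(t⁻¹ * (1 - t)), t⁻¹ * bary T a (γ t), ?_⟩
      rw [mul_smul, ← e, hγ, neg_smul, mul_smul]
      have e2 : x₂ - v = t⁻¹ • t • (x₂ - v) := by rw [smul_smul, inv_mul_cancel₀ ht0.ne', one_smul]
      rw [e2, ← smul_neg, ← smul_add]
      congr 1
      module
    have hfacet : ∀ a b d, Labeled T v a b d → bary T d (γ t) = 0 → U ∈ 𝓝 (γ t) := by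
      intro a b d h hd
      obtain ⟨ha, hb, -⟩ := (mem_cone_iff h).1 hyT
      have ha' : 0 < bary T a (γ t) :=
        lt_of_le_of_ne ha fun h0 => hray b d a h.rotate ⟨hd, h0.symm⟩
      have hb' : 0 < bary T b (γ t) :=
        lt_of_le_of_ne hb fun h0 => hray a b d h ⟨h0.symm, hd⟩
      rcases hC T ⟨hTK, hvT⟩ a b d h with ⟨T', hT'K, hne, ⟨d', h'⟩, hCT'⟩ | hzero
      · refine mem_of_superset (cone_union_mem_nhds hTK hT'K hne h h' ha' hb' hd)
          (Set.union_subset (hsubU hTS) (hsubU (hmemS.2 ⟨hT'K, h'.mem_v, hCT'.trans hCT⟩)))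
      -- An unshared facet would make the value zero; this is the only way the segment could leave
      -- the cones.
      · exact absurd (hCT.symm.trans hzero) h0
    obtain ⟨a, b, d, h⟩ := (isTet_of_mem_cells hTK).exists_labeled_of_one hvT
    obtain ⟨ha, hb, hd⟩ := (mem_cone_iff h).1 hyT
    rcases ha.eq_or_lt with ha | ha
    · exact hfacet b d a h.rotate ha.symm
    rcases hb.eq_or_lt with hb | hb
    · exact hfacet a d b h.swap hb.symm
    rcases hd.eq_or_lt with hd | hd
    · exact hfacet a b d h hd.symm
    exact mem_of_superset (cone_mem_nhds h ha hb hd) (hsubU hTS)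
  have hIcc : Set.Icc (0 : ℝ) 1 ⊆ γ ⁻¹' U := by
    refine ((hUc.preimage hγc).inter isClosed_Icc).Icc_subset_of_forall_mem_nhdsWithin ?_ ?_
    · simpa [hγ] using mem_of_mem_nhds hU1
    · rintro t ⟨htU, ht⟩
      exact nhdsWithin_le_nhds (hγc.continuousAt.preimage_mem_nhds (hstep t ht htU))
  have h2 : x₂ ∈ U := by simpa [hγ] using hIcc (Set.right_mem_Icc.2 zero_le_one)
  obtain ⟨T, hTS, hxT⟩ := Set.mem_iUnion₂.1 h2
  obtain ⟨hTK, hvT, hCT⟩ := hmemS.1 hTS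
  rw [cell_eq_of_mem_cone hT₂K hTK hv₂ hvT hxT hx₂, hCT]

end Patch

end WeakSym

/-! ### Conclusion. -/

theorem mainTheorem6 (K : Geometry.SimplicialComplex ℝ WeakSym.E3) (hK : WeakSym.IsTetMesh K)
    (v : WeakSym.E3) (hv : v ∈ K.vertices) (r : ℕ) (q : WeakSym.E3 → WeakSym.Mat3)
    (hq : q ∈ WeakSym.kerC K r v) :
    WeakSym.ConstOnPatch K v q := by
  obtain ⟨W, hW⟩ := WeakSym.exists_isAxial hq.1
  have hex := fun T (hT : T ∈ WeakSym.patchCells K v) =>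
    WeakSym.exists_const_of_mem_patch hK hW hq hT
  choose! C hC using hex
  have hdich := fun T (hT : T ∈ WeakSym.patchCells K v) a b d (h : WeakSym.Labeled T v a b d) =>
    WeakSym.facet_dichotomy hK hW hq hC hT.1 h
  rcases (WeakSym.patchCells K v).eq_empty_or_nonempty with he | ⟨T₀, hT₀⟩
  · exact ⟨0, fun T hT => absurd hT (by simp [he])⟩
  refine ⟨WeakSym.axl (C T₀), fun T hT x hx => ?_⟩
  rw [hW.eq T hT.1 x hx, hC T hT x hx]
  congr 1
  -- Propagation starts only from a nonzero value. If the reference value is zero, a nonzero value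
  -- elsewhere would propagate back to `T₀`.
  by_cases h0 : C T₀ = 0
  · by_contra hne
    rw [h0] at hne
    exact hne (h0 ▸ (WeakSym.const_of_facet_dichotomy hK hdich hT hT₀ hne).symm)
  · exact WeakSym.const_of_facet_dichotomy hK hdich hT₀ hT h0
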